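/- Let $\mathbb{k}$ be an algebraically closed field, $R = \mathbb{k}[[w]]$, $\mathfrak m = (w)$, $K = \mathbb{k}((w))$, and let $\Lambda = \mathrm{Mat}_{s_1}(K) \times \dots \times \mathrm{Mat}_{s_t}(K)$ with positive integers $s_1, \dots, s_t$, regarded as an $R$-algebra via the diagonal embedding of $R$. An $R$-order with rational envelope $\Lambda$ is an $R$-subalgebra $A \subseteq \Lambda$ which is finitely generated as an $R$-module and satisfies $K \cdot A = \Lambda$. Such an $A$ is nodal if there is a subring $H$ with $A \subseteq H \subseteq \Lambda$, finitely generated as a left $A$-module and hereditary (every left ideal is projective), such that $\mathrm{rad}(A) = \mathrm{rad}(H)$ (Jacobson radicals) and, for each simple left $A$-module $U$, the left $A$-module $H \otimes_A U$ has length at most $2$. A datum $(\Omega, \sigma, \approx, \mathrm{wt})$ consists of the following. $\Omega$ is a finite set and $\sigma$ is a permutation of $\Omega$ with cycles (orbits) $\Omega_1, \dots, \Omega_t$, labelled by $1, \dots, t$. The relation $\approx$ on $\Omega$ is symmetric, not necessarily reflexive, and for each $\omega$ there is at most one $\omega'$ (possibly $\omega' = \omega$) with $\omega \approx \omega'$.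 The set $\Omega^\ddagger$ is obtained from $\Omega$ by replacing each $\omega$ with $\omega \approx \omega$ by two elements $\omega_+, \omega_-$. Finally, $\mathrm{wt}\colon \Omega^\ddagger \to \{1, 2, \dots\}$ is a map with $\mathrm{wt}(\omega') = \mathrm{wt}(\omega'')$ whenever $\omega' \approx \omega''$, $\omega' \neq \omega''$; one puts $\mathrm{wt}(\omega) = \mathrm{wt}(\omega_+) + \mathrm{wt}(\omega_-)$ if $\omega \approx \omega$. A marking is a choice of $\omega_i \in \Omega_i$ for each $i$. Suppose that $\sum_{\omega \in \Omega_i} \mathrm{wt}(\omega) = s_i$ for all $i$. Given a marking, divide the rows and columns of $s_i \times s_i$ matrices into consecutive stripes of sizes $\mathrm{wt}(\omega_i), \mathrm{wt}(\sigma(\omega_i)), \dots, \mathrm{wt}(\sigma^{l_i - 1}(\omega_i))$, where $l_i = |\Omega_i|$, labelled by the elements $\omega_i < \sigma(\omega_i) < \dots < \sigma^{l_i-1}(\omega_i)$ of $\Omega_i$. If $\omega \approx \omega$, divide the stripe $\omega$ further into a first part $\omega_+$ of size $\mathrm{wt}(\omega_+)$ and a second part $\omega_-$ of size $\mathrm{wt}(\omega_-)$.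 Let $A(\Omega, \sigma, \approx, \mathrm{wt}) \subseteq \Lambda$ be the set of all tuples $(X_1, \dots, X_t)$, with $X_i \in \mathrm{Mat}_{s_i}(R)$, such that - the entries of each block $X_i^{(\omega, \omega')}$ with $\omega < \omega'$ in $\Omega_i$ (that is, strictly above the block diagonal) lie in $\mathfrak m$; - $X_{i'}^{(\omega', \omega')}(0) = X_{i''}^{(\omega'', \omega'')}(0)$ for all $\omega' \in \Omega_{i'}$, $\omega'' \in \Omega_{i''}$ with $\omega' \approx \omega''$ and $\omega' \ne \omega''$; - $X_i^{(\omega_+, \omega_-)}(0) = 0$ and $X_i^{(\omega_-, \omega_+)}(0) = 0$ for all $\omega \in \Omega_i$ with $\omega \approx \omega$. **Theorem.** Let $A$ be a nodal order with rational envelope $\Lambda$. Then there exists a datum $(\Omega, \sigma, \approx, \mathrm{wt})$ with $t$ labelled cycles such that $\sum_{\omega \in \Omega_i} \mathrm{wt}(\omega) = s_i$ for all $i$ and such that, for any choice of marking, there is an invertible $S \in \Lambda$ with $$A = S \cdot A(\Omega, \sigma, \approx, \mathrm{wt}) \cdot S^{-1}.$$ -/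

import Mathlib

universe u

/-! ### Modules over noncommutative rings -/

/-- `H` is hereditary: every left ideal is a projective left `H`-module. -/
def IsLeftHereditary (H : Type*) [Ring H] : Prop :=
  ∀ I : Submodule H H, Module.Projective H I

section Induction

variable {A H : Type*} [Ring A] [Ring H]

/-- `H` is finitely generated as a left `A`-module, `A` acting through `f : A → H`. -/
def IsLeftFinite (f : A →+* H) : Prop :=
  letI : Module A H := Module.compHom H f
  Module.Finite A H

open TensorProduct in
/-- The relations `(h · f a) ⊗ u = h ⊗ (a • u)` in `H ⊗_ℤ U`. -/
def balancedRelations (f : A →+* H) (U : Type*) [AddCommGroup U] [Module A U] :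
    Submodule H (H ⊗[ℤ] U) :=
  Submodule.span H {z | ∃ (h : H) (a : A) (u : U), z = (h * f a) ⊗ₜ[ℤ] u - h ⊗ₜ[ℤ] (a • u)}

open TensorProduct in
/-- The left `H`-module `H ⊗_A U`, for a ring homomorphism `f : A → H` (which makes `H` a right
`A`-module) and a left `A`-module `U`. -/
abbrev InducedModule (f : A →+* H) (U : Type*) [AddCommGroup U] [Module A U] : Type _ :=
  (H ⊗[ℤ] U) ⧸ balancedRelations f U

/-- The length `l_A(H ⊗_A U)` of `H ⊗_A U` as a left `A`-module. -/
noncomputable def inducedLength (f : A →+* H) (U : Type*) [AddCommGroup U] [Module A U] : ℕ∞ :=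
  letI : Module A (InducedModule f U) := Module.compHom (InducedModule f U) f
  Module.length A (InducedModule f U)

end Induction

/-! ### Orders and nodal orders -/

section Orders

variable {R : Type*} (K : Type*) {Λ : Type*} [CommRing R] [Field K] [Algebra R K]
  [Ring Λ] [Algebra R Λ] [Algebra K Λ] [IsScalarTower R K Λ]

/-- The `R`-subalgebra `A` of the `K`-algebra `Λ` is an `R`-order with rational envelope `Λ`, where
`K` is the fraction field of the domain `R`: it is a finitely generated `R`-module and `K · A = Λ`.
(Inside a `K`-vector space torsion-freeness, and injectivity of `K ⊗_R A → Λ`, are automatic.) -/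
structure IsOrderWithEnvelope (A : Subalgebra R Λ) : Prop where
  fg : (Subalgebra.toSubmodule A).FG
  span_eq_top : Submodule.span K (A : Set Λ) = ⊤

/-- `H` is an overorder of `A`: it contains `A` and is finitely generated as a left `A`-module. -/
structure IsOverorder (A H : Subalgebra R Λ) : Prop where
  le : A ≤ H
  finite : IsLeftFinite (Subalgebra.inclusion le : A →ₐ[R] H).toRingHom

end Orders

/-- `A` is a nodal `R`-order with rational envelope `Λ`: there is a hereditary overorder `H` with
the same Jacobson radical (as subsets of `Λ`) such that `H ⊗_A U` has length at most two as a left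
`A`-module for each simple left `A`-module `U`. Every simple `A`-module is a quotient of `A`, so it
is enough to let `U` range over the universe of `Λ`. When `R` is a complete discrete valuation ring
the centre of an `R`-order is finite over `R`, hence automatically semilocal and excellent. -/
structure IsNodalOrder {R : Type*} (K : Type*) {Λ : Type u} [CommRing R] [Field K] [Algebra R K]
    [Ring Λ] [Algebra R Λ] [Algebra K Λ] [IsScalarTower R K Λ] (A : Subalgebra R Λ) : Prop where
  isOrder : IsOrderWithEnvelope K A
  exists_cover : ∃ (H : Subalgebra R Λ) (hAH : IsOverorder A H),
    IsLeftHereditary H ∧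
    (Subtype.val '' (Ring.jacobson A : Set A) : Set Λ) =
      Subtype.val '' (Ring.jacobson H : Set H) ∧
    ∀ (U : Type u) [AddCommGroup U] [Module A U], IsSimpleModule A U →
      inducedLength (Subalgebra.inclusion hAH.le : A →ₐ[R] H).toRingHom U ≤ 2

/-! ### The combinatorial data -/

/-- A symmetric, not necessarily reflexive relation `≈` on `Ω` such that each element is related to
at most one element (possibly itself). -/
structure TieRelation (Ω : Type) where
  rel : Ω → Ω → Prop
  symm : ∀ a b, rel a b → rel b a
  unique : ∀ a b c, rel a b → rel a c → b = c

/-- The set `Ω‡`: each reflexive element `ω` is replaced by a pair `ω₊ = (ω, true)`,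
`ω₋ = (ω, false)`; the other elements are kept. -/
def TieRelation.Split {Ω : Type} (T : TieRelation Ω) : Type :=
  {ω : Ω // ¬ T.rel ω ω} ⊕ ({ω : Ω // T.rel ω ω} × Bool)

/-- A weight function on `Ω‡`: positive integers, equal on tied elements. -/
structure WeightFunction {Ω : Type} (T : TieRelation Ω) where
  toFun : T.Split → ℕ
  pos : ∀ x, 0 < toFun x
  tied : ∀ a b : {ω : Ω // ¬ T.rel ω ω}, T.rel a b → toFun (Sum.inl a) = toFun (Sum.inl b)

namespace WeightFunction

variable {Ω : Type} {T : TieRelation Ω} (W : WeightFunction T)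

open Classical in
/-- The induced weight function on `Ω`; `wt ω = wt ω₊ + wt ω₋` for reflexive `ω`. -/
noncomputable def weight (ω : Ω) : ℕ :=
  if h : T.rel ω ω then W.toFun (Sum.inr (⟨ω, h⟩, true)) + W.toFun (Sum.inr (⟨ω, h⟩, false))
  else W.toFun (Sum.inl ⟨ω, h⟩)

theorem weight_eq_of_tied {a b : Ω} (h : T.rel a b) : W.weight a = W.weight b := by
  by_cases hab : a = b
  · rw [hab]
  · have ha : ¬ T.rel a a := fun h' => hab (T.unique a a b h' h)
    have hb : ¬ T.rel b b := fun h' => hab (T.unique b a b (T.symm a b h) h')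
    simp only [weight, dif_neg ha, dif_neg hb]
    exact W.tied ⟨a, ha⟩ ⟨b, hb⟩ h

end WeightFunction

/-- A datum `(Ω, σ, ≈, wt)`, where `σ` has exactly `t` cycles `Ω_1, …, Ω_t`; the map `cyc` sends an
element to the label of its cycle. -/
structure NodalDatum (t : ℕ) where
  Ω : Type
  finite : Finite Ω
  σ : Equiv.Perm Ω
  tie : TieRelation Ω
  wt : WeightFunction tie
  cyc : Ω → Fin t
  cyc_surjective : Function.Surjective cyc
  cyc_eq_iff : ∀ a b, cyc a = cyc b ↔ σ.SameCycle a b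

namespace NodalDatum

variable {t : ℕ} (D : NodalDatum t)

/-- A marking: the choice of an element `ω_i ∈ Ω_i` for each `i`. -/
structure Marking where
  pt : Fin t → D.Ω
  cyc_pt : ∀ i, D.cyc (pt i) = i

variable {D} (m : D.Marking)

/-- `l_i = |Ω_i|`. -/
noncomputable def Marking.cycleLength (_m : D.Marking) (i : Fin t) : ℕ :=
  Nat.card {ω : D.Ω // D.cyc ω = i}

/-- The element `σ^j(ω_i)`, `0 ≤ j < l_i`. -/
def Marking.elt (i : Fin t) (j : Fin (m.cycleLength i)) : D.Ω :=
  (D.σ ^ (j : ℕ)) (m.pt i)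

/-- The vector `p_i = (wt(ω_i), wt(σ(ω_i)), …, wt(σ^{l_i - 1}(ω_i)))`. -/
noncomputable def Marking.p (i : Fin t) (j : Fin (m.cycleLength i)) : ℕ :=
  D.wt.weight (m.elt i j)

theorem Marking.p_eq_of_tied {i i' : Fin t} {j : Fin (m.cycleLength i)}
    {j' : Fin (m.cycleLength i')} (h : D.tie.rel (m.elt i j) (m.elt i' j')) :
    m.p i j = m.p i' j' :=
  D.wt.weight_eq_of_tied h

/-- The row and column positions of the `i`-th matrix factor, as pairs (stripe, position within
the stripe). -/
abbrev Marking.Pos (i : Fin t) : Type :=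
  Σ j : Fin (m.cycleLength i), Fin (m.p i j)

/-- The position `a` in the stripe of a reflexive element `ω` lies in the part labelled `ω₊`, which
consists of the first `wt(ω₊)` positions (the others form the part labelled `ω₋`). -/
def Marking.IsPlus {ω : D.Ω} (h : D.tie.rel ω ω) (a : ℕ) : Prop :=
  a < D.wt.toFun (Sum.inr (⟨ω, h⟩, true))

end NodalDatum

/-! ### The orders attached to the data -/

section StandardOrders

variable (R : Type*) [CommRing R] [IsLocalRing R]

open IsLocalRing in
/-- The standard hereditary order `H(R, p)`, as an algebra of block matrices over `R`: the blocks
strictly above the diagonal have their entries in the maximal ideal. -/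
def standardHereditaryOrder {r : ℕ} (p : Fin r → ℕ) :
    Subalgebra R (Matrix (Σ j : Fin r, Fin (p j)) (Σ j : Fin r, Fin (p j)) R) where
  carrier := {X | ∀ x y, x.1 < y.1 → X x y ∈ maximalIdeal R}
  mul_mem' := by
    intro X Y hX hY x y hxy
    rw [Matrix.mul_apply]
    refine Ideal.sum_mem _ fun z _ => ?_
    rcases lt_or_ge x.1 z.1 with h | h
    · exact Ideal.mul_mem_right _ _ (hX x z h)
    · exact Ideal.mul_mem_left _ _ (hY z y (lt_of_le_of_lt h hxy))
  add_mem' := fun hX hY x y hxy => Ideal.add_mem _ (hX x y hxy) (hY x y hxy)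
  algebraMap_mem' := by
    intro c x y hxy
    have hne : x ≠ y := fun h => by simp [h] at hxy
    simp [Matrix.algebraMap_matrix_apply, hne]

open IsLocalRing in
/-- Reduction modulo the maximal ideal is multiplicative on diagonal blocks of `H(R, p)`. -/
theorem residue_mul_diagonal_block {r : ℕ} {p : Fin r → ℕ}
    {X Y : Matrix (Σ j : Fin r, Fin (p j)) (Σ j : Fin r, Fin (p j)) R}
    (hX : X ∈ standardHereditaryOrder R p) (hY : Y ∈ standardHereditaryOrder R p)
    (j : Fin r) (a b : Fin (p j)) :
    residue R ((X * Y) ⟨j, a⟩ ⟨j, b⟩) =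
      ∑ c : Fin (p j), residue R (X ⟨j, a⟩ ⟨j, c⟩) * residue R (Y ⟨j, c⟩ ⟨j, b⟩) := by
  rw [Matrix.mul_apply, map_sum, Fintype.sum_sigma, Finset.sum_eq_single j]
  · simp
  · intro j' _ hj'
    refine Finset.sum_eq_zero fun c _ => ?_
    rw [residue_eq_zero_iff]
    rcases lt_or_gt_of_ne hj' with h | h
    · exact Ideal.mul_mem_left _ _ (hY ⟨j', c⟩ ⟨j, b⟩ h)
    · exact Ideal.mul_mem_right _ _ (hX ⟨j, a⟩ ⟨j', c⟩ h)
  · simp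

end StandardOrders

namespace NodalDatum

variable (R : Type*) [CommRing R] [IsLocalRing R] {t : ℕ} {D : NodalDatum t} (m : D.Marking)

open IsLocalRing in
/-- The order `A(R, (Ω, σ, ≈, m, wt))` as an algebra of tuples of block matrices over `R`. The
residue of `X i ⟨j, a⟩ ⟨j', b⟩` is the entry `(a, b)` of `X_i^{(ω, ω')}(0)`, where `ω = σ^j(ω_i)`
and `ω' = σ^{j'}(ω_i)`. -/
def Marking.blockOrder : Subalgebra R (∀ i, Matrix (m.Pos i) (m.Pos i) R) where
  carrier := {X |
    (∀ i, X i ∈ standardHereditaryOrder R (m.p i)) ∧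
    (∀ (i i' : Fin t) (j : Fin (m.cycleLength i)) (j' : Fin (m.cycleLength i')),
      ∀ h : D.tie.rel (m.elt i j) (m.elt i' j'), m.elt i j ≠ m.elt i' j' →
      ∀ a b : Fin (m.p i j),
        residue R (X i ⟨j, a⟩ ⟨j, b⟩) =
        residue R (X i' ⟨j', Fin.cast (m.p_eq_of_tied h) a⟩
          ⟨j', Fin.cast (m.p_eq_of_tied h) b⟩)) ∧
    (∀ (i : Fin t) (j : Fin (m.cycleLength i)), ∀ h : D.tie.rel (m.elt i j) (m.elt i j),
      ∀ a b : Fin (m.p i j), ¬ (IsPlus h a ↔ IsPlus h b) →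
        residue R (X i ⟨j, a⟩ ⟨j, b⟩) = 0)}
  mul_mem' := by
    rintro X Y ⟨hX, hX1, hX2⟩ ⟨hY, hY1, hY2⟩
    refine ⟨fun i => mul_mem (hX i) (hY i), ?_, ?_⟩
    · intro i i' j j' h hne a b
      rw [Pi.mul_apply, Pi.mul_apply, residue_mul_diagonal_block R (hX i) (hY i),
        residue_mul_diagonal_block R (hX i') (hY i')]
      refine Fintype.sum_equiv (finCongr (m.p_eq_of_tied h)) _ _ fun c => ?_
      rw [hX1 i i' j j' h hne a c, hY1 i i' j j' h hne c b]
      rfl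
    · intro i j h a b hab
      rw [Pi.mul_apply, residue_mul_diagonal_block R (hX i) (hY i)]
      refine Finset.sum_eq_zero fun c _ => ?_
      by_cases hac : (IsPlus h a ↔ IsPlus h c)
      · rw [hY2 i j h c b (fun hcb => hab (hac.trans hcb)), mul_zero]
      · rw [hX2 i j h a c hac, zero_mul]
  add_mem' := by
    rintro X Y ⟨hX, hX1, hX2⟩ ⟨hY, hY1, hY2⟩
    refine ⟨fun i => add_mem (hX i) (hY i), ?_, ?_⟩
    · intro i i' j j' h hne a b
      simp only [Pi.add_apply, Matrix.add_apply, map_add]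
      rw [hX1 i i' j j' h hne a b, hY1 i i' j j' h hne a b]
    · intro i j h a b hab
      simp only [Pi.add_apply, Matrix.add_apply, map_add]
      rw [hX2 i j h a b hab, hY2 i j h a b hab, add_zero]
  algebraMap_mem' := by
    intro c
    refine ⟨fun i => (standardHereditaryOrder R (m.p i)).algebraMap_mem c, ?_, ?_⟩
    · intro i i' j j' h hne a b
      simp [Pi.algebraMap_apply, Matrix.algebraMap_matrix_apply]
    · intro i j h a b hab
      have hne : a ≠ b := fun h' => hab (by rw [h'])
      simp [Pi.algebraMap_apply, Matrix.algebraMap_matrix_apply, hne]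

/-- Numbering of the rows (and columns) of the `i`-th matrix factor, stripe after stripe, when
`|p_i| = s_i`. -/
noncomputable def Marking.posEquiv {s : Fin t → ℕ} (hs : ∀ i, ∑ j, m.p i j = s i) (i : Fin t) :
    m.Pos i ≃ Fin (s i) :=
  finSigmaFinEquiv.trans (finCongr (hs i))

/-- The inclusion of tuples of block matrices over `R` into
`Λ = Mat_{s_1}(K) × … × Mat_{s_t}(K)`. -/
noncomputable def Marking.toEnvelope (K : Type*) [Field K] [Algebra R K] {s : Fin t → ℕ}
    (hs : ∀ i, ∑ j, m.p i j = s i) :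
    (∀ i, Matrix (m.Pos i) (m.Pos i) R) →ₐ[R] (∀ i, Matrix (Fin (s i)) (Fin (s i)) K) :=
  AlgHom.pi fun i =>
    ((Matrix.reindexAlgEquiv R K (m.posEquiv hs i)).toAlgHom.comp
      (Algebra.ofId R K).mapMatrix).comp (Pi.evalAlgHom R _ i)

/-- The order `A(R, (Ω, σ, ≈, m, wt))` inside `Λ = Mat_{s_1}(K) × … × Mat_{s_t}(K)`. -/
noncomputable def Marking.order (K : Type*) [Field K] [Algebra R K] {s : Fin t → ℕ}
    (hs : ∀ i, ∑ j, m.p i j = s i) : Subalgebra R (∀ i, Matrix (Fin (s i)) (Fin (s i)) K) :=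
  (m.blockOrder R).map (m.toEnvelope R K hs)

end NodalDatum

/-! Let H be a hereditary cover of A. Heredity is used only for left ideals with two generators:
such an ideal is projective, so the surjection from H² onto it splits. For the ideal generated by a
single column, scaled into H, the splitting yields a rank-one idempotent of H below any given
nonzero idempotent. Hence 1 is a sum of orthogonal rank-one idempotents of H, and after conjugation
H contains all diagonal matrix units (`exists_unit_conj_single_mem`). Then H is cut out entry by
entry: the (a, b) entry ranges over w^n(a,b) k[[w]] (`exists_isTiled`). A second use of the
splitting gives n(a,b) + n(b,a) ≤ 1 (`IsTiled.add_le_one`). A diagonal rescaling brings all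
exponents to 0 or 1, and "exponent 0" becomes a total preorder on the rows, so H is block triangular
modulo w (`exists_conj_blockTriangular`).

Therefore H / rad H is a product of matrix algebras over k, one for each block ω = (i, l). Since rad
A = rad H, the order A is the full preimage of its image C in H / rad H, and C is semisimple, that
is, a product of algebras Mat_{d_τ}(k) because k is algebraically closed. Restricted to C, the
column space of each block is a direct sum of standard column modules, its constituents, labelled by
the indices τ. The length of H ⊗_A U_τ is at least the number of ordered pairs of constituents of a
common block whose first member has label τ (`card_constituentPair_le_inducedLength`). The bound 2
leaves three cases: τ occurs once, alone in its block (an untied block); it occurs in exactly two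
blocks, alone in each (two tied blocks); or it occurs once, in a block with one further constituent
of another label (a block tied to itself). So C is given by the gluing conditions of a datum
(`HasFewConstituentPairs.exists_datum`), and the base change in H / rad H lifts to a unit of H
(`exists_glued_form_of_nodal`).

The permutation σ shifts the levels cyclically. Another marking rotates their order, which amounts
to a conjugation by a monomial matrix (`cyclicDatum_exists_conj_order`). -/

/-! ### Laurent series filtered by order of vanishing. -/

section LaurentOrder

variable {k : Type u} [Field k]

/-- The Laurent series `x` lies in `w ^ n k[[w]]`. -/
def OrdGE (n : ℤ) (x : LaurentSeries k) : Prop := ∀ j < n, x.coeff j = 0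

/-- The Laurent monomial `w ^ n`. -/
noncomputable def monom (k : Type u) [Field k] (n : ℤ) : LaurentSeries k := HahnSeries.single n 1

theorem OrdGE.mono {n m : ℤ} {x : LaurentSeries k} (h : OrdGE n x) (hm : m ≤ n) : OrdGE m x :=
  fun j hj => h j (hj.trans_le hm)

theorem ordGE_zero (n : ℤ) : OrdGE n (0 : LaurentSeries k) := fun _ _ => rfl

theorem OrdGE.add {n : ℤ} {x y : LaurentSeries k} (hx : OrdGE n x) (hy : OrdGE n y) :
    OrdGE n (x + y) := fun j hj => by simp [hx j hj, hy j hj]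

theorem OrdGE.sum {n : ℤ} {ι : Type*} (s : Finset ι) {f : ι → LaurentSeries k}
    (h : ∀ i ∈ s, OrdGE n (f i)) : OrdGE n (∑ i ∈ s, f i) := by
  classical
  induction s using Finset.induction_on with
  | empty => simpa using ordGE_zero n
  | insert a s ha ih =>
    rw [Finset.sum_insert ha]
    exact (h a (by simp)).add (ih fun i hi => h i (by simp [hi]))

theorem OrdGE.mul {n m : ℤ} {x y : LaurentSeries k} (hx : OrdGE n x) (hy : OrdGE m y) :
    OrdGE (n + m) (x * y) := by
  intro j hj
  rw [HahnSeries.coeff_mul]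
  refine Finset.sum_eq_zero fun a ha => ?_
  rw [Finset.mem_antidiagonal] at ha
  rcases lt_or_ge a.1 n with h | h
  · rw [hx _ h, zero_mul]
  · rw [hy a.2 (by lia), mul_zero]

theorem OrdGE.coeff_mul {n m : ℤ} {x y : LaurentSeries k} (hx : OrdGE n x) (hy : OrdGE m y) :
    (x * y).coeff (n + m) = x.coeff n * y.coeff m := by
  rw [HahnSeries.coeff_mul, Finset.sum_eq_single (n, m)]
  · intro a ha hne
    rw [Finset.mem_antidiagonal] at ha
    rcases lt_or_ge a.1 n with h | h
    · rw [hx _ h, zero_mul]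
    · rcases lt_or_ge a.2 m with h' | h'
      · rw [hy _ h', mul_zero]
      · exact absurd (Prod.ext (by lia) (by lia)) hne
  · intro h
    rw [Finset.mem_antidiagonal] at h
    by_contra hne
    exact h ⟨left_ne_zero_of_mul hne, right_ne_zero_of_mul hne, rfl⟩

theorem exists_ordGE (x : LaurentSeries k) : ∃ n, OrdGE n x :=
  ⟨x.order, fun _ hj => HahnSeries.coeff_eq_zero_of_lt_order hj⟩

theorem exists_ordGE_coeff_ne_zero {x : LaurentSeries k} (hx : x ≠ 0) :
    ∃ n, OrdGE n x ∧ x.coeff n ≠ 0 :=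
  ⟨x.order, fun _ hj => HahnSeries.coeff_eq_zero_of_lt_order hj,
    HahnSeries.coeff_order_eq_zero.not.mpr hx⟩

theorem coeff_algebraMap_natCast (r : PowerSeries k) (n : ℕ) :
    (algebraMap (PowerSeries k) (LaurentSeries k) r).coeff n = PowerSeries.coeff n r := by
  rw [LaurentSeries.coe_algebraMap, LaurentSeries.coeff_coe_powerSeries]

theorem ordGE_algebraMap (r : PowerSeries k) :
    OrdGE 0 (algebraMap (PowerSeries k) (LaurentSeries k) r) := by
  intro j hj
  rw [LaurentSeries.coe_algebraMap, PowerSeries.coeff_coe, if_pos hj]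

theorem coeff_zero_algebraMap (r : PowerSeries k) :
    (algebraMap (PowerSeries k) (LaurentSeries k) r).coeff 0 = PowerSeries.constantCoeff r := by
  simpa using coeff_algebraMap_natCast r 0

theorem exists_algebraMap_eq {x : LaurentSeries k} (hx : OrdGE 0 x) :
    ∃ r, algebraMap (PowerSeries k) (LaurentSeries k) r = x := by
  refine ⟨PowerSeries.mk fun n => x.coeff n, ?_⟩
  ext j
  rw [LaurentSeries.coe_algebraMap, PowerSeries.coeff_coe]
  split_ifs with h
  · exact (hx j h).symm
  · rw [PowerSeries.coeff_mk, Int.natAbs_of_nonneg (by lia)]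

theorem monom_add (n m : ℤ) : monom k (n + m) = monom k n * monom k m := by
  simp [monom, HahnSeries.single_mul_single]

theorem monom_zero : monom k 0 = 1 := rfl

theorem monom_mul_monom_neg (n : ℤ) : monom k n * monom k (-n) = 1 := by
  rw [← monom_add, add_neg_cancel, monom_zero]

theorem coeff_monom_mul (n j : ℤ) (x : LaurentSeries k) :
    (monom k n * x).coeff j = x.coeff (j - n) := by
  rw [monom, HahnSeries.coeff_single_mul, one_mul]

theorem ordGE_monom_mul {n m : ℤ} {x : LaurentSeries k} :
    OrdGE n (monom k m * x) ↔ OrdGE (n - m) x := by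
  constructor
  · intro h j hj
    have := h (j + m) (by lia)
    rwa [coeff_monom_mul, add_sub_cancel_right] at this
  · intro h j hj
    rw [coeff_monom_mul]
    exact h _ (by lia)

/-- The inverse of a series of exact order n has order -n, so y / x is a power series. -/
theorem exists_smul_eq_of_ordGE {n : ℤ} {x y : LaurentSeries k} (hx : OrdGE n x)
    (hx' : x.coeff n ≠ 0) (hy : OrdGE n y) : ∃ r : PowerSeries k, r • x = y := by
  have hx0 : x ≠ 0 := by rintro rfl; simp at hx'
  have hxi0 : x⁻¹ ≠ 0 := inv_ne_zero hx0
  obtain ⟨m, hm, hm'⟩ := exists_ordGE_coeff_ne_zero hxi0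
  -- The leading coefficients of x and x⁻¹ multiply to a nonzero coefficient of 1 in degree n + m.
  have hnm : n + m = 0 := by
    have h1 := hx.coeff_mul hm
    rw [mul_inv_cancel₀ hx0] at h1
    by_contra hne
    rw [← HahnSeries.single_zero_one, HahnSeries.coeff_single_of_ne hne] at h1
    exact mul_ne_zero hx' hm' h1.symm
  obtain ⟨r, hr⟩ := exists_algebraMap_eq (x := x⁻¹ * y) (by
    have := hm.mul hy
    rwa [add_comm, hnm] at this)
  refine ⟨r, ?_⟩
  rw [Algebra.smul_def, hr, mul_right_comm, inv_mul_cancel₀ hx0, one_mul]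

end LaurentOrder

/-! ### Splittings provided by heredity. -/

section Splitting

variable {R L : Type*} [CommRing R] [Ring L] [Algebra R L]

/-- For any two elements `y₁, y₂` of `H`, the surjection `H² → H y₁ + H y₂` has an `H`-linear
section, with matrix `(p₁, p₂; q₁, q₂)`. -/
def HasTwoGeneratorSplitting (H : Subalgebra R L) : Prop :=
  ∀ y₁ ∈ H, ∀ y₂ ∈ H, ∃ p₁ ∈ H, ∃ p₂ ∈ H, ∃ q₁ ∈ H, ∃ q₂ ∈ H,
    p₁ * y₁ + p₂ * y₂ = y₁ ∧ q₁ * y₁ + q₂ * y₂ = y₂ ∧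
    ∀ h₁ ∈ H, ∀ h₂ ∈ H, h₁ * y₁ + h₂ * y₂ = 0 →
      h₁ * p₁ + h₂ * q₁ = 0 ∧ h₁ * p₂ + h₂ * q₂ = 0

/-- The left ideal generated by y₁ and y₂ is projective, so it has a section σ into H². The
coefficients are the coordinates of σ y₁ and σ y₂, and σ carries a relation between y₁ and y₂ to the
same relation between these coordinates. -/
theorem IsLeftHereditary.hasTwoGeneratorSplitting {H : Subalgebra R L}
    (hH : IsLeftHereditary H) : HasTwoGeneratorSplitting H := by
  intro y₁ hy₁ y₂ hy₂
  let Y₁ : H := ⟨y₁, hy₁⟩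
  let Y₂ : H := ⟨y₂, hy₂⟩
  let φ : H × H →ₗ[H] H :=
    (LinearMap.toSpanSingleton H H Y₁).coprod (LinearMap.toSpanSingleton H H Y₂)
  have hφ : ∀ a b, φ (a, b) = a * Y₁ + b * Y₂ := fun a b => by simp [φ]
  have := hH (LinearMap.range φ)
  obtain ⟨σ, hσ⟩ := Module.projective_lifting_property φ.rangeRestrict
    (LinearMap.id : LinearMap.range φ →ₗ[H] _) φ.surjective_rangeRestrict
  have key : ∀ u, φ (σ u) = u := fun u => congrArg Subtype.val (LinearMap.congr_fun hσ u)
  let u₁ : LinearMap.range φ := ⟨Y₁, (1, 0), by simp [hφ]⟩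
  let u₂ : LinearMap.range φ := ⟨Y₂, (0, 1), by simp [hφ]⟩
  refine ⟨_, (σ u₁).1.2, _, (σ u₁).2.2, _, (σ u₂).1.2, _, (σ u₂).2.2, ?_, ?_, ?_⟩
  · have := congrArg Subtype.val (key u₁)
    rw [← Prod.mk.eta (p := σ u₁), hφ] at this
    exact this
  · have := congrArg Subtype.val (key u₂)
    rw [← Prod.mk.eta (p := σ u₂), hφ] at this
    exact this
  · intro h₁ hh₁ h₂ hh₂ h
    have h0 : (⟨h₁, hh₁⟩ : H) • u₁ + (⟨h₂, hh₂⟩ : H) • u₂ = 0 := Subtype.ext (Subtype.ext h)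
    have h1 := congrArg σ h0
    rw [map_add, map_smul, map_smul, map_zero] at h1
    exact ⟨congrArg Subtype.val (congrArg Prod.fst h1), congrArg Subtype.val (congrArg Prod.snd h1)⟩

theorem HasTwoGeneratorSplitting.map {L' : Type*} [Ring L'] [Algebra R L'] {H : Subalgebra R L}
    (hH : HasTwoGeneratorSplitting H) (e : L →ₐ[R] L') :
    Function.Injective e → HasTwoGeneratorSplitting (H.map e) := by
  rintro he _ ⟨y₁, hy₁, rfl⟩ _ ⟨y₂, hy₂, rfl⟩
  obtain ⟨p₁, hp₁, p₂, hp₂, q₁, hq₁, q₂, hq₂, e₁, e₂, h⟩ := hH y₁ hy₁ y₂ hy₂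
  refine ⟨_, ⟨p₁, hp₁, rfl⟩, _, ⟨p₂, hp₂, rfl⟩, _, ⟨q₁, hq₁, rfl⟩, _, ⟨q₂, hq₂, rfl⟩, ?_, ?_, ?_⟩
  · exact (by simpa using congrArg e e₁)
  · exact (by simpa using congrArg e e₂)
  · rintro _ ⟨h₁, hh₁, rfl⟩ _ ⟨h₂, hh₂, rfl⟩ h0
    have h0' : e (h₁ * y₁ + h₂ * y₂) = e 0 := by simpa using h0
    obtain ⟨a, b⟩ := h h₁ hh₁ h₂ hh₂ (he h0')
    exact ⟨by simpa using congrArg e a, by simpa using congrArg e b⟩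

end Splitting

/-! ### Rank-one idempotents in a hereditary order. -/

section RankOne

variable {K : Type*} [Field K] {t : ℕ} {s : Fin t → ℕ}

/-- The tuple of matrices `f` has a single nonzero component, which is a product of a column and a
row. -/
def IsColumnTimesRow (f : ∀ i, Matrix (Fin (s i)) (Fin (s i)) K) : Prop :=
  ∃ (i : Fin t) (c d : Fin (s i) → K), f = Pi.single i (Matrix.vecMulVec c d)

theorem exists_eq_vecMulVec {n m : Type*} [Fintype n] [DecidableEq n] {c : n → K} (hc : c ≠ 0)
    (P : Matrix n m K) (h : ∀ M : Matrix n n K, M.mulVec c = 0 → M * P = 0) :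
    ∃ d, P = Matrix.vecMulVec c d := by
  obtain ⟨x, hx⟩ := Function.ne_iff.mp hc
  -- The test matrix c_x · 1 - c e_xᵀ kills c; that it kills P says that c_x P is the product of c
  -- and the row x of P.
  have h1 := h (c x • 1 - Matrix.vecMulVec c (Pi.single x 1)) (by
    rw [Matrix.sub_mulVec, Matrix.smul_mulVec, Matrix.one_mulVec, Matrix.vecMulVec_mulVec]
    ext y
    simp [mul_comm])
  refine ⟨(c x)⁻¹ • P x, ?_⟩
  rw [Matrix.sub_mul, Matrix.smul_mul, Matrix.one_mul, sub_eq_zero, Matrix.vecMulVec_mul] at h1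
  ext y z
  have h2 := congrFun (congrFun h1 y) z
  rw [Matrix.single_one_vecMul] at h2
  simp only [Matrix.smul_apply, Matrix.vecMulVec_apply, smul_eq_mul, Pi.smul_apply] at h2 ⊢
  have hx' : c x ≠ 0 := hx
  field_simp
  rw [mul_comm, h2]
  rfl

variable {R : Type*} [CommRing R] [Algebra R K]

/-- Every element of the ambient algebra has a nonzero scalar multiple in `H`. -/
def IsFull (R : Type*) {L : Type*} [CommRing R] [Ring L] [Algebra R L] (H : Subalgebra R L) :
    Prop :=
  ∀ X : L, ∃ r : R, r ≠ 0 ∧ r • X ∈ H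

variable [FaithfulSMul R K] {H : Subalgebra R (∀ i, Matrix (Fin (s i)) (Fin (s i)) K)}

theorem smul_pi_matrix_eq_zero {r : R} (hr : r ≠ 0)
    {X : ∀ i, Matrix (Fin (s i)) (Fin (s i)) K} (h : r • X = 0) : X = 0 := by
  ext i a b
  have := congrFun (congrFun (congrFun h i) a) b
  rw [Pi.smul_apply, Matrix.smul_apply, Algebra.smul_def] at this
  refine (mul_eq_zero.mp this).resolve_left fun h0 => hr ?_
  exact (FaithfulSMul.algebraMap_eq_zero_iff R K).mp h0

/-- Take a nonzero column c of e, so that e c = c, and the matrix y₀ with the single nonzero column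
c. Projectivity of the left ideal generated by a multiple of y₀ gives p in H which fixes y₀ and is
killed by every X that kills y₀. Testing with e - 1 and p - 1 gives e p = p and p² = p, and the
columns of p are multiples of c. -/
theorem exists_rankOne_idempotent_le (hsp : HasTwoGeneratorSplitting H) (hfull : IsFull R H)
    {e : ∀ i, Matrix (Fin (s i)) (Fin (s i)) K} (heH : e ∈ H) (he : e * e = e) (he0 : e ≠ 0) :
    ∃ f ∈ H, f * f = f ∧ e * f = f ∧ f * e = f ∧ f ≠ 0 ∧ IsColumnTimesRow f := by
  obtain ⟨i, hi⟩ := Function.ne_iff.mp he0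
  obtain ⟨j, hj⟩ : ∃ j, (e i).col j ≠ 0 := by
    by_contra! h
    exact hi (Matrix.ext fun a b => congrFun (h b) a)
  set c := (e i).col j with hc
  have hec : (e i).mulVec c = c := by
    ext a
    have := congrFun (congrFun (congrFun he i) a) j
    rw [Pi.mul_apply, Matrix.mul_apply] at this
    exact this
  let y₀ : ∀ i, Matrix (Fin (s i)) (Fin (s i)) K :=
    Pi.single i (Matrix.vecMulVec c (Pi.single j 1))
  have hmul : ∀ X : ∀ i, Matrix (Fin (s i)) (Fin (s i)) K,
      X * y₀ = Pi.single i (Matrix.vecMulVec ((X i).mulVec c) (Pi.single j 1)) := by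
    intro X
    ext1 i'
    by_cases h : i' = i
    · subst h
      simp [y₀, Matrix.mul_vecMulVec]
    · simp [y₀, h]
  have hy₀ : y₀ ≠ 0 := by
    obtain ⟨a, ha⟩ := Function.ne_iff.mp hj
    intro h
    have := congrFun (congrFun (congrFun h i) a) j
    simp only [y₀, Pi.single_eq_same, Matrix.vecMulVec_apply, mul_one] at this
    exact ha this
  obtain ⟨r, hr, hrH⟩ := hfull y₀
  have hey : e * (r • y₀) = r • y₀ := by
    rw [mul_smul_comm, hmul, hec]
  -- One generator suffices here, so the second is 0.
  obtain ⟨p, hp, p₂, _, q₁, _, q₂, _, h1, _, h3⟩ := hsp _ hrH 0 H.zero_mem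
  rw [mul_zero, add_zero] at h1
  -- The splitting controls only X in H; fullness extends the conclusion to the whole ambient
  -- algebra.
  have hann : ∀ X, X * y₀ = 0 → X * p = 0 := by
    intro X hX
    obtain ⟨r', hr', hX'⟩ := hfull X
    have := (h3 _ hX' 0 H.zero_mem (by rw [smul_mul_smul_comm, hX]; simp)).1
    rw [zero_mul, add_zero, smul_mul_assoc] at this
    exact smul_pi_matrix_eq_zero hr' this
  have hann' : ∀ X, X * (r • y₀) = 0 → X * p = 0 := by
    intro X hX
    rw [mul_smul_comm] at hX
    exact hann X (smul_pi_matrix_eq_zero hr hX)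
  have hep : e * p = p := by
    have := hann' (e - 1) (by rw [sub_mul, one_mul, hey, sub_self])
    rwa [sub_mul, one_mul, sub_eq_zero] at this
  have hpp : p * p = p := by
    have := hann' (p - 1) (by rw [sub_mul, one_mul, h1, sub_self])
    rwa [sub_mul, one_mul, sub_eq_zero] at this
  -- The right factor e places the idempotent below e on both sides; p itself satisfies only e p =
  -- p.
  refine ⟨p * e, H.mul_mem hp heH, ?_, ?_, ?_, ?_, ?_⟩
  · rw [mul_assoc, ← mul_assoc e, hep, ← mul_assoc, hpp]
  · rw [← mul_assoc, hep]
  · rw [mul_assoc, he]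
  · intro h
    have h2 : p * e * (r • y₀) = r • y₀ := by rw [mul_assoc, hey, h1]
    rw [h, zero_mul] at h2
    exact hy₀ (smul_pi_matrix_eq_zero hr h2.symm)
  · obtain ⟨d, hd⟩ := exists_eq_vecMulVec hj (p i) (by
      intro M hM
      have := hann (Pi.single i M) (by rw [hmul, Pi.single_eq_same, hM]; simp)
      simpa using congrFun this i)
    refine ⟨i, c, Matrix.vecMul d (e i), ?_⟩
    ext1 i'
    by_cases h : i' = i
    · subst h
      rw [Pi.mul_apply, hd, Matrix.vecMulVec_mul, Pi.single_eq_same]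
    · have := hann (Pi.single i' 1) (by
        rw [hmul, Pi.single_eq_of_ne (Ne.symm h)]; simp)
      have := congrFun this i'
      rw [Pi.mul_apply, Pi.single_eq_same, one_mul] at this
      rw [Pi.mul_apply, this, Pi.single_eq_of_ne h]
      simp

/-- Split off a rank-one idempotent f below e. The remainder e - f is an idempotent orthogonal to f
which generates a strictly smaller right ideal of the ambient algebra, so induction on the dimension
applies. -/
theorem exists_rankOne_decomposition (hsp : HasTwoGeneratorSplitting H) (hfull : IsFull R H)
    {e : ∀ i, Matrix (Fin (s i)) (Fin (s i)) K} (heH : e ∈ H) (he : e * e = e) :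
    ∃ (n : ℕ) (f : Fin n → ∀ i, Matrix (Fin (s i)) (Fin (s i)) K),
      (∀ a, f a ∈ H ∧ f a ≠ 0 ∧ IsColumnTimesRow (f a)) ∧
      (∀ a b, f a * f b = if a = b then f a else 0) ∧ ∑ a, f a = e := by
  induction hN : Module.finrank K (LinearMap.range (LinearMap.mulLeft K e)) using
    Nat.strong_induction_on generalizing e with
  | _ N ih =>
  by_cases he0 : e = 0
  · exact ⟨0, Fin.elim0, fun a => a.elim0, fun a => a.elim0, by simp [he0]⟩
  obtain ⟨f, hfH, hff, hef, hfe, hf0, hf⟩ := exists_rankOne_idempotent_le hsp hfull heH he he0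
  have hidem : (e - f) * (e - f) = e - f := by
    rw [mul_sub, sub_mul, sub_mul, he, hfe, hef, hff, sub_self, sub_zero]
  have hfef : f * (e - f) = 0 := by rw [mul_sub, hfe, hff, sub_self]
  have heff : (e - f) * f = 0 := by rw [sub_mul, hef, hff, sub_self]
  have hlt : LinearMap.range (LinearMap.mulLeft K (e - f)) <
      LinearMap.range (LinearMap.mulLeft K e) := by
    refine lt_of_le_of_ne ?_ fun h => ?_
    · rintro _ ⟨x, rfl⟩
      refine ⟨(e - f) * x, ?_⟩
      rw [LinearMap.mulLeft_apply, LinearMap.mulLeft_apply, ← mul_assoc, mul_sub, he, hef]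
    · have : f ∈ LinearMap.range (LinearMap.mulLeft K e) := ⟨f, hef⟩
      rw [← h] at this
      obtain ⟨x, hx⟩ := this
      rw [LinearMap.mulLeft_apply] at hx
      apply hf0
      rw [← hff]
      nth_rewrite 2 [← hx]
      rw [← mul_assoc, hfef, zero_mul]
  obtain ⟨n, F, hF, hFF, hsum⟩ := ih _ (hN ▸ Submodule.finrank_lt_finrank_of_lt hlt)
    (H.sub_mem heH hfH) hidem rfl
  have hl : ∀ a, (e - f) * F a = F a := by
    intro a
    rw [← hsum, Finset.sum_mul]
    simp [hFF]
  have hr : ∀ a, F a * (e - f) = F a := by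
    intro a
    rw [← hsum, Finset.mul_sum]
    simp [hFF]
  refine ⟨n + 1, Fin.cons f F, ?_, ?_, ?_⟩
  · intro a
    refine Fin.cases ?_ (fun a => ?_) a
    · exact ⟨hfH, hf0, hf⟩
    · exact hF a
  · intro a b
    refine Fin.cases ?_ (fun a => ?_) a <;> refine Fin.cases ?_ (fun b => ?_) b
    · simp [hff]
    · rw [Fin.cons_zero, Fin.cons_succ, ← hl b, ← mul_assoc, hfef, zero_mul,
        if_neg (Fin.succ_ne_zero b).symm]
    · rw [Fin.cons_zero, Fin.cons_succ, ← hr a, mul_assoc, heff, mul_zero,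
        if_neg (Fin.succ_ne_zero a)]
    · simp [hFF]
  · rw [Fin.sum_univ_succ]
    simp [hsum]

/-- Write the idempotents of a decomposition of 1 as columns times rows, and collect those of
component i in matrices C and D. That they sum to 1 means C D = 1, and orthogonality means D C = 1.
So C is square and invertible, and conjugation by it sends diagonal matrix units to the given
idempotents. -/
theorem exists_unit_conj_single_mem (hsp : HasTwoGeneratorSplitting H) (hfull : IsFull R H) :
    ∃ S : (∀ i, Matrix (Fin (s i)) (Fin (s i)) K)ˣ,
      ∀ (i : Fin t) (a : Fin (s i)), S.val * Pi.single i (Matrix.single a a 1) * S⁻¹.val ∈ H := by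
  obtain ⟨n, f, hf, hff, hsum⟩ := exists_rankOne_decomposition hsp hfull H.one_mem (mul_one 1)
  have hvec : ∀ a, ∃ (i : Fin t) (c d : ∀ i, Fin (s i) → K),
      f a = Pi.single i (Matrix.vecMulVec (c i) (d i)) := by
    intro a
    obtain ⟨i, c, d, h⟩ := (hf a).2.2
    -- The vectors are extended by zero to all components, which frees their type from the component
    -- of the idempotent.
    exact ⟨i, Pi.single i c, Pi.single i d, by rw [h, Pi.single_eq_same, Pi.single_eq_same]⟩
  choose I c d hcd using hvec
  let C : ∀ i, Matrix (Fin (s i)) {a // I a = i} K := fun i => Matrix.of fun x a =>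
    c a.1 i x
  let D : ∀ i, Matrix {a // I a = i} (Fin (s i)) K := fun i => Matrix.of fun a x =>
    d a.1 i x
  have hcomp : ∀ i (a : {a // I a = i}),
      f a.1 = Pi.single i (Matrix.vecMulVec ((C i).col a) (D i a)) := by
    rintro _ ⟨a, rfl⟩
    exact hcd a
  have hcomp0 : ∀ i a, I a ≠ i → f a i = 0 := by
    intro i a h
    rw [hcd a, Pi.single_eq_of_ne (Ne.symm h)]
  have hCD : ∀ i, C i * D i = 1 := by
    intro i
    have h1 : ∑ a, f a i = 1 := by simpa using congrFun hsum i
    ext x y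
    rw [← h1, Matrix.sum_apply, Matrix.mul_apply]
    rw [← Fintype.sum_subtype_add_sum_subtype (fun a => I a = i)]
    rw [Finset.sum_eq_zero (s := (Finset.univ : Finset {a // ¬ I a = i})), add_zero]
    · refine Finset.sum_congr rfl fun a _ => ?_
      rw [hcomp i a, Pi.single_eq_same, Matrix.vecMulVec_apply]
      rfl
    · intro a _
      rw [hcomp0 i a a.2]
      rfl
  have hne : ∀ i (a : {a // I a = i}), (C i).col a ≠ 0 ∧ D i a ≠ 0 := by
    intro i a
    constructor <;> intro h <;> apply (hf a.1).2.1 <;> rw [hcomp i a, h] <;> simp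
  have hDC : ∀ i, D i * C i = 1 := by
    intro i
    ext a b
    have h1 := congrFun (hff a.1 b.1) i
    rw [Pi.mul_apply, hcomp i a, hcomp i b, Pi.single_eq_same, Pi.single_eq_same,
      Matrix.vecMulVec_mul_vecMulVec] at h1
    obtain ⟨x, hx⟩ := Function.ne_iff.mp (hne i a).1
    obtain ⟨y, hy⟩ := Function.ne_iff.mp (hne i b).2
    have h2 := congrFun (congrFun h1 x) y
    have h3 : (D i * C i) a b = D i a ⬝ᵥ (C i).col b := rfl
    rw [h3]
    by_cases hab : a = b
    · subst hab
      rw [if_pos rfl, Pi.single_eq_same] at h2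
      simp only [Matrix.vecMulVec_apply, Pi.smul_apply, smul_eq_mul] at h2
      rw [Matrix.one_apply_eq]
      have : (C i).col a x * D i a y ≠ 0 := mul_ne_zero hx hy
      apply mul_right_cancel₀ this
      rw [one_mul]
      convert h2 using 1
      simp; ring
    · rw [if_neg (fun h => hab (Subtype.ext h))] at h2
      simp only [Matrix.vecMulVec_apply, Pi.smul_apply, smul_eq_mul, Pi.zero_apply,
        Matrix.zero_apply] at h2
      rw [Matrix.one_apply_ne hab]
      have : (C i).col a x * D i b y ≠ 0 := mul_ne_zero hx hy
      apply mul_right_cancel₀ this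
      rw [zero_mul, ← h2]
      simp; ring
  have hcard : ∀ i, Fintype.card (Fin (s i)) = Fintype.card {a // I a = i} :=
    fun i => Matrix.square_of_invertible _ _ (hCD i) (hDC i)
  let κ : ∀ i, Fin (s i) ≃ {a // I a = i} := fun i => Fintype.equivOfCardEq (hcard i)
  refine ⟨⟨fun i => (C i).submatrix id (κ i), fun i => (D i).submatrix (κ i) id, ?_, ?_⟩, ?_⟩
  · ext1 i
    rw [Pi.mul_apply, Matrix.submatrix_mul_equiv, hCD]
    simp
  · ext1 i
    rw [Pi.mul_apply, Matrix.submatrix_mul _ _ _ _ _ Function.bijective_id |>.symm, hDC]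
    simp
  · intro i a
    convert (hf (κ i a).1).1 using 1
    rw [hcomp i]
    ext1 i'
    by_cases h : i' = i
    · subst h
      ext x y
      simp only [Units.inv_mk, Pi.mul_apply, Pi.single_eq_same]
      rw [Matrix.mul_apply, Finset.sum_eq_single a]
      · simp [Matrix.mul_apply, Matrix.single_apply, Matrix.vecMulVec_apply]
      · intro b _ hb
        rw [Matrix.mul_single_apply_of_ne _ _ _ _ _ hb, zero_mul]
      · simp
    · simp [h]

end RankOne

/-! ### Conjugation, and level functions from exponents. -/

/-- Conjugation `X ↦ S X S⁻¹` by a unit, as an algebra homomorphism. -/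
def conjAlgHom (R : Type*) {L : Type*} [CommRing R] [Ring L] [Algebra R L] (S : Lˣ) :
    L →ₐ[R] L where
  toFun X := S.val * X * S⁻¹.val
  map_one' := by simp
  map_mul' X Y := by simp [mul_assoc]
  map_zero' := by simp
  map_add' X Y := by rw [mul_add, add_mul]
  commutes' r := by rw [← Algebra.commutes r, mul_assoc, Units.mul_inv, mul_one]

theorem conjAlgHom_apply {R L : Type*} [CommRing R] [Ring L] [Algebra R L] (S : Lˣ) (X : L) :
    conjAlgHom R S X = S.val * X * S⁻¹.val := rfl

theorem mem_map_conjAlgHom_inv {R L : Type*} [CommRing R] [Ring L] [Algebra R L] (S : Lˣ)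
    {H : Subalgebra R L} {X : L} :
    X ∈ H.map (conjAlgHom R S⁻¹) ↔ S.val * X * S⁻¹.val ∈ H := by
  constructor
  · rintro ⟨Y, hY, rfl⟩
    have : S.val * (S⁻¹.val * Y * S⁻¹⁻¹.val) * S⁻¹.val = Y := by simp [mul_assoc]
    rw [← this] at hY
    exact hY
  · intro h
    refine ⟨_, h, ?_⟩
    change S⁻¹.val * (S.val * X * S⁻¹.val) * S⁻¹⁻¹.val = X
    simp [mul_assoc]

theorem conjAlgHom_injective {R L : Type*} [CommRing R] [Ring L] [Algebra R L] (S : Lˣ) :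
    Function.Injective (conjAlgHom R S) := by
  intro X Y h
  simpa [conjAlgHom_apply] using h

theorem IsFull.map_conjAlgHom {R L : Type*} [CommRing R] [Ring L] [Algebra R L] (S : Lˣ)
    {H : Subalgebra R L} (h : IsFull R H) : IsFull R (H.map (conjAlgHom R S⁻¹)) := by
  intro X
  obtain ⟨r, hr, hX⟩ := h (S.val * X * S⁻¹.val)
  refine ⟨r, hr, mem_map_conjAlgHom_inv S |>.mpr ?_⟩
  rwa [mul_smul_comm, smul_mul_assoc]

theorem exists_level_function {α : Type*} [Fintype α] (g : α → ℕ) :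
    ∃ (r : ℕ) (ℓ : α → Fin r), Function.Surjective ℓ ∧ ∀ a b, ℓ a < ℓ b ↔ g a < g b := by
  classical
  let I := Finset.univ.image g
  let o := I.orderIsoOfFin rfl
  have hI : ∀ a, g a ∈ I := fun a => Finset.mem_image_of_mem g (Finset.mem_univ a)
  refine ⟨I.card, fun a => o.symm ⟨g a, hI a⟩, ?_, ?_⟩
  · intro j
    obtain ⟨a, -, ha⟩ := Finset.mem_image.mp (o j).2
    refine ⟨a, ?_⟩
    rw [OrderIso.symm_apply_eq]
    exact Subtype.ext ha
  · intro a b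
    rw [OrderIso.lt_iff_lt]
    rfl

/-- By the triangle inequality and `htot`, the relation n a b = 0 is a total preorder. With D a the
set of x such that n a x = 0, it says that D b ⊆ D a. The sets D a therefore form a chain, and their
cardinalities serve as levels. -/
theorem exists_level_function_of_exponents {α : Type*} [Fintype α] {n : α → α → ℤ}
    (h01 : ∀ a b, n a b = 0 ∨ n a b = 1) (hrefl : ∀ a, n a a = 0)
    (htri : ∀ a b c, n a c ≤ n a b + n b c) (htot : ∀ a b, n a b + n b a ≤ 1) :
    ∃ (r : ℕ) (ℓ : α → Fin r), Function.Surjective ℓ ∧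
      ∀ a b, n a b = if ℓ a < ℓ b then 1 else 0 := by
  classical
  let D : α → Finset α := fun a => Finset.univ.filter fun x => n a x = 0
  have hD : ∀ a b, n a b = 0 → D b ⊆ D a := by
    intro a b h x hx
    simp only [D, Finset.mem_filter, Finset.mem_univ, true_and] at hx ⊢
    have := htri a b x
    have := h01 a x
    lia
  obtain ⟨r, ℓ, hℓ, h⟩ := exists_level_function fun a => (D a).card
  refine ⟨r, ℓ, hℓ, fun a b => ?_⟩
  split_ifs with hab
  · rw [h] at hab
    refine (h01 a b).resolve_left fun h0 => ?_
    exact absurd (Finset.card_le_card (hD a b h0)) (by lia)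
  · rw [h] at hab
    by_contra h0
    have h1 := (h01 a b).resolve_left h0
    have h2 : n b a = 0 := by
      have := htot a b
      have := h01 b a
      lia
    refine hab (Finset.card_lt_card ⟨hD b a h2, fun hle => ?_⟩)
    have hb : b ∈ D b := by simp [D, hrefl]
    have := hle hb
    simp only [D, Finset.mem_filter, Finset.mem_univ, true_and] at this
    lia

/-! ### Tiled orders and the shape of a hereditary order. -/

section Tiled

variable {k : Type u} [Field k] {t : ℕ} {s : Fin t → ℕ}

/-- Monomial matrices: conjugation by them permutes and rescales the entries. -/
theorem exists_monomial_unit (π : ∀ i, Equiv.Perm (Fin (s i))) (δ : ∀ i, Fin (s i) → ℤ) :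
    ∃ T : (∀ i, Matrix (Fin (s i)) (Fin (s i)) (LaurentSeries k))ˣ, ∀ M i x y,
      (T.val * M * T⁻¹.val) i x y = monom k (δ i x - δ i y) * M i (π i x) (π i y) := by
  let P : ∀ i, Matrix (Fin (s i)) (Fin (s i)) (LaurentSeries k) := fun i =>
    Matrix.of fun x y => if y = π i x then monom k (δ i x) else 0
  let Q : ∀ i, Matrix (Fin (s i)) (Fin (s i)) (LaurentSeries k) := fun i =>
    Matrix.of fun x y => if x = π i y then monom k (-δ i y) else 0
  have hPM : ∀ (M : ∀ i, Matrix (Fin (s i)) (Fin (s i)) (LaurentSeries k)) i x y,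
      (P * M) i x y = monom k (δ i x) * M i (π i x) y := by
    intro M i x y
    simp [P, Matrix.mul_apply]
  have hMQ : ∀ (M : ∀ i, Matrix (Fin (s i)) (Fin (s i)) (LaurentSeries k)) i x y,
      (M * Q) i x y = M i x (π i y) * monom k (-δ i y) := by
    intro M i x y
    simp [Q, Matrix.mul_apply]
  have hPQ : P * Q = 1 := by
    ext1 i
    ext1 x y
    rw [hPM]
    by_cases h : x = y
    · subst h
      simp [Q, monom_mul_monom_neg]
    · simp [Q, h]
  have hQP : Q * P = 1 := by
    ext1 i
    exact mul_eq_one_comm.mp (congrFun hPQ i)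
  refine ⟨⟨P, Q, hPQ, hQP⟩, fun M i x y => ?_⟩
  rw [Units.inv_mk]
  change (P * M * Q) i x y = _
  rw [hMQ, hPM, sub_eq_add_neg, monom_add]
  ring

/-- The tuple with the single entry `x` at the place `(a, b)` of the `i`-th matrix. -/
noncomputable def unitEntry (i : Fin t) (a b : Fin (s i)) (x : LaurentSeries k) :
    ∀ i, Matrix (Fin (s i)) (Fin (s i)) (LaurentSeries k) :=
  Pi.single i (Matrix.single a b x)

theorem unitEntry_mul_unitEntry (i : Fin t) (a b c : Fin (s i)) (x y : LaurentSeries k) :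
    unitEntry i a b x * unitEntry i b c y = unitEntry i a c (x * y) := by
  rw [unitEntry, unitEntry, unitEntry, ← Pi.single_mul, Matrix.single_mul_single_same]

theorem unitEntry_apply_same (i : Fin t) (a b : Fin (s i)) (x : LaurentSeries k) :
    unitEntry i a b x i a b = x := by
  simp [unitEntry]

theorem unitEntry_mul_apply (i : Fin t) (a b c : Fin (s i)) (x : LaurentSeries k)
    (X : ∀ i, Matrix (Fin (s i)) (Fin (s i)) (LaurentSeries k)) :
    (unitEntry i a b x * X) i a c = x * X i b c := by
  simp [unitEntry, Matrix.mul_apply, Matrix.single_apply]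

theorem mul_unitEntry_apply (i : Fin t) (a b c : Fin (s i)) (x : LaurentSeries k)
    (X : ∀ i, Matrix (Fin (s i)) (Fin (s i)) (LaurentSeries k)) :
    (X * unitEntry i b c x) i a c = X i a b * x := by
  simp [unitEntry, Matrix.mul_apply, Matrix.single_apply]

theorem unitEntry_one_mul_mul (i : Fin t) (a b : Fin (s i))
    (X : ∀ i, Matrix (Fin (s i)) (Fin (s i)) (LaurentSeries k)) :
    unitEntry i a a 1 * X * unitEntry i b b 1 = unitEntry i a b (X i a b) := by
  ext1 i'
  by_cases h : i' = i
  · subst h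
    ext1 x y
    simp only [unitEntry, Pi.mul_apply, Pi.single_eq_same]
    rw [Matrix.single_mul_mul_single]
    simp
  · simp [unitEntry, h]

theorem sum_unitEntry (X : ∀ i, Matrix (Fin (s i)) (Fin (s i)) (LaurentSeries k)) :
    ∑ i, ∑ a, ∑ b, unitEntry i a b (X i a b) = X := by
  conv_rhs => rw [← Finset.univ_sum_single X]
  refine Finset.sum_congr rfl fun i _ => ?_
  conv_rhs => rw [Matrix.matrix_eq_sum_single (X i)]
  have : ∀ Y : Matrix (Fin (s i)) (Fin (s i)) (LaurentSeries k), (Pi.single i Y :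
      ∀ i, Matrix (Fin (s i)) (Fin (s i)) (LaurentSeries k)) =
      AddMonoidHom.single (fun i => Matrix (Fin (s i)) (Fin (s i)) (LaurentSeries k)) i Y :=
    fun _ => rfl
  simp only [unitEntry, this, map_sum]

/-- The subalgebra `H` consists of the tuples of matrices whose `(a, b)` entries in the `i`-th
component lie in `w ^ n i a b k[[w]]`. -/
def IsTiled (H : Subalgebra (PowerSeries k) (∀ i, Matrix (Fin (s i)) (Fin (s i)) (LaurentSeries k)))
    (n : ∀ i, Fin (s i) → Fin (s i) → ℤ) : Prop :=
  ∀ X, X ∈ H ↔ ∀ i a b, OrdGE (n i a b) (X i a b)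

/-- The entries of the elements of `H` have poles of bounded order. -/
def HasBoundedPoles
    (H : Subalgebra (PowerSeries k) (∀ i, Matrix (Fin (s i)) (Fin (s i)) (LaurentSeries k))) :
    Prop :=
  ∃ N : ℤ, ∀ X ∈ H, ∀ i a b, OrdGE N (X i a b)

variable {H : Subalgebra (PowerSeries k) (∀ i, Matrix (Fin (s i)) (Fin (s i)) (LaurentSeries k))}

theorem exists_ordGE_entries (X : ∀ i, Matrix (Fin (s i)) (Fin (s i)) (LaurentSeries k)) :
    ∃ M, ∀ i a b, OrdGE M (X i a b) := by
  choose f hf using fun p : Σ i, Fin (s i) × Fin (s i) => exists_ordGE (X p.1 p.2.1 p.2.2)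
  obtain ⟨M, hM⟩ := (Set.finite_range f).bddBelow
  exact ⟨M, fun i a b => (hf ⟨i, a, b⟩).mono (hM ⟨_, rfl⟩)⟩

theorem HasBoundedPoles.map_conjAlgHom (h : HasBoundedPoles H)
    (S : (∀ i, Matrix (Fin (s i)) (Fin (s i)) (LaurentSeries k))ˣ) :
    HasBoundedPoles (H.map (conjAlgHom (PowerSeries k) S)) := by
  obtain ⟨N, hN⟩ := h
  obtain ⟨M, hM⟩ := exists_ordGE_entries S.val
  obtain ⟨M', hM'⟩ := exists_ordGE_entries S⁻¹.val
  refine ⟨M + N + M', ?_⟩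
  rintro _ ⟨X, hX, rfl⟩ i a b
  change OrdGE _ ((S.val i * X i * S⁻¹.val i) a b)
  rw [Matrix.mul_apply]
  refine OrdGE.sum _ fun c _ => OrdGE.mul ?_ (hM' _ _ _)
  rw [Matrix.mul_apply]
  exact OrdGE.sum _ fun d _ => OrdGE.mul (hM _ _ _) (hN X hX _ _ _)

/-- With the diagonal matrix units in H, an element lies in H as soon as each of its entries, placed
alone in a matrix, does. The admissible values of the (a, b) entry form a k[[w]]-submodule of
k((w)), nonzero by fullness and of bounded poles, hence a power of w times k[[w]]. -/
theorem exists_isTiled (hone : ∀ i a, unitEntry i a a 1 ∈ H) (hfull : IsFull (PowerSeries k) H)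
    (hbdd : HasBoundedPoles H) : ∃ n, IsTiled H n := by
  obtain ⟨N, hN⟩ := hbdd
  have hentry : ∀ X ∈ H, ∀ i a b, unitEntry i a b (X i a b) ∈ H := by
    intro X hX i a b
    rw [← unitEntry_one_mul_mul]
    exact H.mul_mem (H.mul_mem (hone i a) hX) (hone i b)
  have hex : ∀ i (a b : Fin (s i)), ∃ n : ℤ, ∀ x, unitEntry i a b x ∈ H ↔ OrdGE n x := by
    intro i a b
    let P : ℤ → Prop := fun n => ∃ x, unitEntry i a b x ∈ H ∧ OrdGE n x ∧ x.coeff n ≠ 0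
    have hP : ∃ n, P n := by
      obtain ⟨r, hr, h⟩ := hfull (unitEntry i a b 1)
      have h' := hentry _ h i a b
      have hne : (r • unitEntry i a b (1 : LaurentSeries k)) i a b ≠ 0 := by
        rw [Pi.smul_apply, Matrix.smul_apply, unitEntry_apply_same, Algebra.smul_def, mul_one]
        exact fun h => hr ((FaithfulSMul.algebraMap_eq_zero_iff _ _).mp h)
      obtain ⟨n, hn⟩ := exists_ordGE_coeff_ne_zero hne
      exact ⟨n, _, h', hn⟩
    obtain ⟨n, ⟨x, hx, hx1, hx2⟩, hmin⟩ := Int.exists_least_of_bdd (P := P) ⟨N, by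
      rintro z ⟨x, hx, hx1, hx2⟩
      by_contra! hz
      have := hN _ hx i a b
      rw [unitEntry_apply_same] at this
      exact hx2 (this z hz)⟩ hP
    refine ⟨n, fun y => ⟨fun hy => ?_, fun hy => ?_⟩⟩
    · by_cases h0 : y = 0
      · rw [h0]; exact ordGE_zero n
      · obtain ⟨m, hm, hm'⟩ := exists_ordGE_coeff_ne_zero h0
        exact hm.mono (hmin m ⟨y, hy, hm, hm'⟩)
    · obtain ⟨r, rfl⟩ := exists_smul_eq_of_ordGE hx1 hx2 hy
      have : unitEntry i a b (r • x) = r • unitEntry i a b x := by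
        rw [unitEntry, unitEntry, ← Pi.single_smul, Matrix.smul_single]
      rw [this]
      exact H.smul_mem hx r
  choose n hn using hex
  refine ⟨n, fun X => ⟨fun hX i a b => (hn i a b _).mp (hentry X hX i a b), fun hX => ?_⟩⟩
  rw [← sum_unitEntry X]
  exact sum_mem fun i _ => sum_mem fun a _ => sum_mem fun b _ => (hn i a b _).mpr (hX i a b)

theorem IsTiled.unitEntry_mem {n : ∀ i, Fin (s i) → Fin (s i) → ℤ} (h : IsTiled H n) {i : Fin t}
    {a b : Fin (s i)} {x : LaurentSeries k} (hx : OrdGE (n i a b) x) : unitEntry i a b x ∈ H := by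
  rw [h]
  intro i' a' b'
  by_cases hi : i' = i
  · subst hi
    rw [unitEntry, Pi.single_eq_same, Matrix.single_apply]
    split_ifs with h1
    · rwa [← h1.1, ← h1.2]
    · exact ordGE_zero _
  · rw [unitEntry, Pi.single_eq_of_ne hi]
    exact ordGE_zero _

theorem ordGE_monom (n : ℤ) : OrdGE n (monom k n) := by
  rw [← mul_one (monom k n), ordGE_monom_mul, sub_self, ← map_one (algebraMap (PowerSeries k) _)]
  exact ordGE_algebraMap 1

theorem coeff_monom_self (n : ℤ) : (monom k n).coeff n = 1 := by
  simp [monom]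

theorem OrdGE.le_of_monom {n m : ℤ} (h : OrdGE n (monom k m)) : n ≤ m := by
  by_contra! hlt
  have := h m hlt
  rw [coeff_monom_self] at this
  exact one_ne_zero this

theorem IsTiled.triangle {n : ∀ i, Fin (s i) → Fin (s i) → ℤ} (h : IsTiled H n) (i : Fin t)
    (a b c : Fin (s i)) : n i a c ≤ n i a b + n i b c := by
  have h1 := H.mul_mem (h.unitEntry_mem (ordGE_monom (n i a b)))
    (h.unitEntry_mem (ordGE_monom (n i b c)))
  rw [unitEntry_mul_unitEntry, ← monom_add, h] at h1
  have h2 := h1 i a c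
  rw [unitEntry_apply_same] at h2
  exact h2.le_of_monom

theorem IsTiled.diagonal {n : ∀ i, Fin (s i) → Fin (s i) → ℤ} (h : IsTiled H n) (i : Fin t)
    (a : Fin (s i)) : n i a a = 0 := by
  refine le_antisymm ?_ (by have := h.triangle i a a a; lia)
  have := (h 1).mp H.one_mem i a a
  rw [Pi.one_apply, Matrix.one_apply_eq, ← monom_zero] at this
  exact this.le_of_monom

/-- If the sum were at least 2, the left ideal generated by w e_aa and w^n(b,a) e_ba would not be
projective. Multiplying the second generator by w^n(a,b) e_ab gives a multiple of the first, with a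
factor divisible by w. Applied to this relation, a splitting forces the constant term of the (a, a)
entry of p₁ to vanish, whereas p₁ y₁ + p₂ y₂ = y₁ forces it to be 1. -/
theorem IsTiled.add_le_one {n : ∀ i, Fin (s i) → Fin (s i) → ℤ} (h : IsTiled H n)
    (hsp : HasTwoGeneratorSplitting H) (i : Fin t) (a b : Fin (s i)) :
    n i a b + n i b a ≤ 1 := by
  by_contra! hlt
  obtain ⟨p₁, hp₁, p₂, hp₂, q₁, hq₁, q₂, hq₂, h1, -, h3⟩ :=
    hsp (unitEntry i a a (monom k 1))
      (h.unitEntry_mem (by rw [h.diagonal]; exact (ordGE_monom 1).mono zero_le_one))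
      (unitEntry i b a (monom k (n i b a))) (h.unitEntry_mem (ordGE_monom _))
  have h4 := (h3 (unitEntry i a a (-monom k (n i a b + n i b a - 1))) (h.unitEntry_mem (by
      rw [h.diagonal]
      intro j hj
      rw [HahnSeries.coeff_neg, (ordGE_monom _).mono _ j hj, neg_zero]
      lia))
    (unitEntry i a b (monom k (n i a b))) (h.unitEntry_mem (ordGE_monom _)) (by
      rw [unitEntry_mul_unitEntry, unitEntry_mul_unitEntry, neg_mul, ← monom_add, ← monom_add,
        sub_add_cancel, unitEntry, unitEntry, ← Pi.single_add, ← Matrix.single_add, neg_add_cancel]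
      simp)).1
  have h5 := congrFun (congrFun (congrFun h4 i) a) a
  rw [Pi.add_apply, Matrix.add_apply, unitEntry_mul_apply, unitEntry_mul_apply] at h5
  -- Compare coefficients in degree n(a,b) + n(b,a) - 1; the other term would need the coefficient
  -- of q₁ in degree n(b,a) - 1, which vanishes.
  have h6 : (p₁ i a a).coeff 0 = 0 := by
    have := congrArg (fun x : LaurentSeries k => x.coeff (n i a b + n i b a - 1)) h5
    simp only [neg_mul, HahnSeries.coeff_add, HahnSeries.coeff_neg, coeff_monom_mul,
      sub_self] at this
    rw [(h q₁).mp hq₁ i b a _ (by lia), add_zero] at this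
    simpa using this
  have h7 := congrFun (congrFun (congrFun h1 i) a) a
  rw [Pi.add_apply, Matrix.add_apply, mul_unitEntry_apply, mul_unitEntry_apply,
    unitEntry_apply_same, mul_comm, mul_comm (p₂ i a b)] at h7
  have h8 := congrArg (fun x : LaurentSeries k => x.coeff 1) h7
  simp only [HahnSeries.coeff_add, coeff_monom_mul, sub_self, coeff_monom_self] at h8
  -- The entry of p₂ contributes its coefficient in degree 1 - n(b,a), which is less than n(a,b) by
  -- assumption.
  rw [h6, (h p₂).mp hp₂ i a b _ (by lia), add_zero] at h8
  exact zero_ne_one h8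

/-- A hereditary order in a product of matrix algebras over `k((w))` is conjugate to an order of
block triangular matrices modulo `w`. -/
theorem exists_conj_blockTriangular (hs : ∀ i, 0 < s i) (hsp : HasTwoGeneratorSplitting H)
    (hfull : IsFull (PowerSeries k) H) (hbdd : HasBoundedPoles H) :
    ∃ (S : (∀ i, Matrix (Fin (s i)) (Fin (s i)) (LaurentSeries k))ˣ) (r : Fin t → ℕ)
      (ℓ : ∀ i, Fin (s i) → Fin (r i)), (∀ i, Function.Surjective (ℓ i)) ∧
      ∀ X, S.val * X * S⁻¹.val ∈ H ↔
        ∀ i a b, OrdGE (if ℓ i a < ℓ i b then 1 else 0) (X i a b) := by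
  obtain ⟨S, hS⟩ := exists_unit_conj_single_mem hsp hfull
  obtain ⟨n, hn⟩ := exists_isTiled (H := H.map (conjAlgHom _ S⁻¹))
    (fun i a => (mem_map_conjAlgHom_inv S).mpr (hS i a)) (hfull.map_conjAlgHom S)
    (hbdd.map_conjAlgHom S⁻¹)
  have hsp' := hsp.map (conjAlgHom _ S⁻¹) (conjAlgHom_injective S⁻¹)
  let o : ∀ i, Fin (s i) := fun i => ⟨0, hs i⟩
  -- Rescaling the row a by w^n(a,o) normalises the exponents in the column of the reference index o
  -- to 0.
  obtain ⟨T, hT⟩ := exists_monomial_unit (k := k) (fun i => Equiv.refl (Fin (s i)))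
    fun i a => n i a (o i)
  -- The new exponent is nonnegative by the triangle inequality through b. It is at most 1 because
  -- n(a,b) ≤ n(a,o) + n(o,b) and n(o,b) + n(b,o) ≤ 1.
  have hlev : ∀ i, ∃ (r : ℕ) (ℓ : Fin (s i) → Fin r), Function.Surjective ℓ ∧
      ∀ a b, n i a b + n i b (o i) - n i a (o i) = if ℓ a < ℓ b then 1 else 0 := by
    intro i
    refine exists_level_function_of_exponents
      (n := fun a b => n i a b + n i b (o i) - n i a (o i)) ?_ ?_ ?_ ?_
    · intro a b
      have h1 := hn.triangle i a b (o i)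
      have h2 := hn.triangle i a (o i) b
      have h3 := hn.add_le_one hsp' i (o i) b
      lia
    · intro a
      have := hn.diagonal i a
      lia
    · intro a b c
      have := hn.triangle i a b c
      lia
    · intro a b
      have := hn.add_le_one hsp' i a b
      lia
  choose r ℓ hℓ hℓ' using hlev
  refine ⟨S * T, r, ℓ, hℓ, fun X => ?_⟩
  have : (S * T).val * X * (S * T)⁻¹.val = S.val * (T.val * X * T⁻¹.val) * S⁻¹.val := by
    simp [mul_assoc]
  rw [this, ← mem_map_conjAlgHom_inv, hn]
  refine forall_congr' fun i => forall_congr' fun a => forall_congr' fun b => ?_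
  rw [hT, ordGE_monom_mul, ← hℓ' i a b, Equiv.refl_apply, Equiv.refl_apply]
  have : n i a b - (n i a (o i) - n i b (o i)) = n i a b + n i b (o i) - n i a (o i) := by ring
  rw [this]

end Tiled

/-! ### Orders are full and have bounded poles. -/

theorem IsOrderWithEnvelope.isFull {R K L : Type*} [CommRing R] [IsDomain R] [Field K] [Algebra R K]
    [IsFractionRing R K] [Ring L] [Algebra R L] [Algebra K L] [IsScalarTower R K L]
    {A : Subalgebra R L} (hA : IsOrderWithEnvelope K A) : IsFull R A := by
  intro X
  have hX : X ∈ Submodule.span K (A : Set L) := hA.span_eq_top ▸ Submodule.mem_top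
  induction hX using Submodule.span_induction with
  | mem x hx => exact ⟨1, one_ne_zero, by rwa [one_smul]⟩
  | zero => exact ⟨1, one_ne_zero, by rw [smul_zero]; exact A.zero_mem⟩
  | add x y _ _ hx hy =>
    obtain ⟨r, hr, hx⟩ := hx
    obtain ⟨r', hr', hy⟩ := hy
    refine ⟨r * r', mul_ne_zero hr hr', ?_⟩
    rw [smul_add, mul_comm, mul_smul, mul_comm, mul_smul]
    exact A.add_mem (A.smul_mem hx _) (A.smul_mem hy _)
  | smul c x _ hx =>
    obtain ⟨r, hr, hx⟩ := hx
    obtain ⟨a, b, hb, rfl⟩ := IsFractionRing.div_surjective (A := R) c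
    have hb0 : b ≠ 0 := nonZeroDivisors.ne_zero hb
    refine ⟨r * b, mul_ne_zero hr hb0, ?_⟩
    have : (r * b) • (algebraMap R K a / algebraMap R K b) • x = a • r • x := by
      rw [← algebraMap_smul K (r * b), ← algebraMap_smul K a, ← algebraMap_smul K r x, smul_smul,
        smul_smul, map_mul]
      congr 1
      have : algebraMap R K b ≠ 0 := by simpa using hb0
      field_simp
    rw [this]
    exact A.smul_mem hx _

theorem IsFull.mono {R L : Type*} [CommRing R] [Ring L] [Algebra R L] {A H : Subalgebra R L}
    (h : IsFull R A) (hle : A ≤ H) : IsFull R H := fun X =>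
  let ⟨r, hr, hX⟩ := h X
  ⟨r, hr, hle hX⟩

section Poles

variable {k : Type u} [Field k] {t : ℕ} {s : Fin t → ℕ}
  {A H : Subalgebra (PowerSeries k) (∀ i, Matrix (Fin (s i)) (Fin (s i)) (LaurentSeries k))}

theorem exists_ordGE_of_finite {ι : Type*} [Finite ι]
    (X : ι → ∀ i, Matrix (Fin (s i)) (Fin (s i)) (LaurentSeries k)) :
    ∃ N, ∀ j i a b, OrdGE N (X j i a b) := by
  choose f hf using fun j => exists_ordGE_entries (X j)
  obtain ⟨M, hM⟩ := (Set.finite_range f).bddBelow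
  exact ⟨M, fun j i a b => (hf j i a b).mono (hM ⟨_, rfl⟩)⟩

theorem hasBoundedPoles_of_fg (h : (Subalgebra.toSubmodule A).FG) : HasBoundedPoles A := by
  obtain ⟨F, hF⟩ := h
  obtain ⟨N, hN⟩ := exists_ordGE_of_finite fun x : F => x.1
  refine ⟨N, fun X hX => ?_⟩
  rw [← Subalgebra.mem_toSubmodule, ← hF] at hX
  induction hX using Submodule.span_induction with
  | mem x hx => exact hN ⟨x, hx⟩
  | zero => exact fun i a b => ordGE_zero N
  | add x y _ _ hx hy => exact fun i a b => (hx i a b).add (hy i a b)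
  | smul r x _ hx =>
    intro i a b
    rw [Pi.smul_apply, Matrix.smul_apply, Algebra.smul_def]
    have := (ordGE_algebraMap r).mul (hx i a b)
    rwa [zero_add] at this

/-- Finite generation over A writes every element as a sum of products a g_j with finitely many
fixed g_j, so the pole bounds add. -/
theorem IsOverorder.hasBoundedPoles (hAH : IsOverorder A H) (hA : HasBoundedPoles A) :
    HasBoundedPoles H := by
  obtain ⟨N, hN⟩ := hA
  let f : A →+* H := (Subalgebra.inclusion hAH.le : A →ₐ[PowerSeries k] H).toRingHom
  let : Module A H := Module.compHom H f
  have hfin : Module.Finite A H := hAH.finite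
  obtain ⟨n, g, hg⟩ := Module.Finite.exists_fin (R := A) (M := H)
  obtain ⟨M, hM⟩ := exists_ordGE_of_finite fun j => (g j).1
  refine ⟨N + M, fun X hX => ?_⟩
  have hX' : (⟨X, hX⟩ : H) ∈ Submodule.span A (Set.range g) := hg ▸ Submodule.mem_top
  obtain ⟨c, hc⟩ := (Submodule.mem_span_range_iff_exists_fun A).mp hX'
  have hXsum : X = ∑ j, (c j).1 * (g j).1 := by
    have h1 := congrArg H.val hc
    rw [map_sum] at h1
    exact h1.symm
  intro i a b
  rw [hXsum, Finset.sum_apply, Matrix.sum_apply]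
  refine OrdGE.sum _ fun j _ => ?_
  rw [Pi.mul_apply, Matrix.mul_apply]
  exact OrdGE.sum _ fun d _ => (hN _ (c j).2 i a d).mul (hM j i d b)

end Poles

/-! ### Block triangular orders and their residue algebra. -/

section Residue

variable {k : Type u} [Field k] {t : ℕ} {s r : Fin t → ℕ}

/-- The rows of the `i`-th matrix which have level `l`, for `ω = (i, l)`. -/
abbrev LevelFiber (ℓ : ∀ i, Fin (s i) → Fin (r i)) (ω : Σ i, Fin (r i)) : Type :=
  {a : Fin (s ω.1) // ℓ ω.1 a = ω.2}

/-- The product of the matrix algebras of the diagonal blocks over the residue field. -/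
abbrev ResidueBlocks (k : Type u) (ℓ : ∀ i, Fin (s i) → Fin (r i)) : Type u :=
  ∀ ω : Σ i, Fin (r i), Matrix (LevelFiber ℓ ω) (LevelFiber ℓ ω) k

/-- Tuples of matrices over `k[[w]]` which are block triangular modulo `w`. -/
def IsBlockTri (ℓ : ∀ i, Fin (s i) → Fin (r i))
    (X : ∀ i, Matrix (Fin (s i)) (Fin (s i)) (LaurentSeries k)) : Prop :=
  ∀ i a b, OrdGE (if ℓ i a < ℓ i b then 1 else 0) (X i a b)

variable {ℓ : ∀ i, Fin (s i) → Fin (r i)}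

theorem IsBlockTri.ordGE_zero {X : ∀ i, Matrix (Fin (s i)) (Fin (s i)) (LaurentSeries k)}
    (h : IsBlockTri ℓ X) (i : Fin t) (a b : Fin (s i)) : OrdGE 0 (X i a b) :=
  (h i a b).mono (by split_ifs <;> simp)

theorem IsBlockTri.coeff_zero {X : ∀ i, Matrix (Fin (s i)) (Fin (s i)) (LaurentSeries k)}
    (h : IsBlockTri ℓ X) {i : Fin t} {a b : Fin (s i)} (hab : ℓ i a < ℓ i b) :
    (X i a b).coeff 0 = 0 :=
  h i a b 0 (by rw [if_pos hab]; exact zero_lt_one)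

theorem isBlockTri_iff {X : ∀ i, Matrix (Fin (s i)) (Fin (s i)) (LaurentSeries k)} :
    IsBlockTri ℓ X ↔ (∀ i a b, OrdGE 0 (X i a b)) ∧
      ∀ i a b, ℓ i a < ℓ i b → (X i a b).coeff 0 = 0 := by
  refine ⟨fun h => ⟨h.ordGE_zero, fun i a b => h.coeff_zero⟩, fun h i a b => ?_⟩
  split_ifs with hab
  · intro j hj
    rcases lt_or_ge j 0 with h' | h'
    · exact h.1 i a b j h'
    · obtain rfl : j = 0 := by lia
      exact h.2 i a b hab
  · exact h.1 i a b

theorem coeff_zero_mul_apply {X Y : ∀ i, Matrix (Fin (s i)) (Fin (s i)) (LaurentSeries k)}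
    (hX : ∀ i a b, OrdGE 0 (X i a b)) (hY : ∀ i a b, OrdGE 0 (Y i a b)) (i : Fin t)
    (a b : Fin (s i)) :
    ((X * Y) i a b).coeff 0 = ∑ c, (X i a c).coeff 0 * (Y i c b).coeff 0 := by
  rw [Pi.mul_apply, Matrix.mul_apply, HahnSeries.coeff_sum]
  exact Finset.sum_congr rfl fun c _ => (hX i a c).coeff_mul (hY i c b)

variable (k ℓ) in
/-- The order of tuples of matrices over `k[[w]]` which are block triangular modulo `w`. -/
def blockTriOrder :
    Subalgebra (PowerSeries k) (∀ i, Matrix (Fin (s i)) (Fin (s i)) (LaurentSeries k)) where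
  carrier := {X | IsBlockTri ℓ X}
  mul_mem' := by
    intro X Y hX hY
    refine isBlockTri_iff.mpr ⟨fun i a b => ?_, fun i a b hab => ?_⟩
    · rw [Pi.mul_apply, Matrix.mul_apply]
      refine OrdGE.sum _ fun c _ => ?_
      have := (hX.ordGE_zero i a c).mul (hY.ordGE_zero i c b)
      rwa [add_zero] at this
    · rw [coeff_zero_mul_apply hX.ordGE_zero hY.ordGE_zero]
      refine Finset.sum_eq_zero fun c _ => ?_
      rcases lt_or_ge (ℓ i a) (ℓ i c) with h | h
      · rw [hX.coeff_zero h, zero_mul]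
      · rw [hY.coeff_zero (h.trans_lt hab), mul_zero]
  add_mem' := fun hX hY i a b => (hX i a b).add (hY i a b)
  algebraMap_mem' := by
    intro c
    refine isBlockTri_iff.mpr ⟨fun i a b => ?_, fun i a b hab => ?_⟩ <;>
      rw [Pi.algebraMap_apply, Matrix.algebraMap_matrix_apply]
    · split_ifs
      · exact ordGE_algebraMap c
      · exact _root_.ordGE_zero 0
    · rw [if_neg (by rintro rfl; exact lt_irrefl _ hab)]
      rfl

theorem sum_levelFiber {i : Fin t} {l : Fin (r i)} {f : Fin (s i) → k}
    (h : ∀ c, ℓ i c ≠ l → f c = 0) : ∑ c, f c = ∑ c : LevelFiber ℓ ⟨i, l⟩, f c.1 := by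
  rw [← Fintype.sum_subtype_add_sum_subtype (fun c => ℓ i c = l)]
  rw [Finset.sum_eq_zero (s := (Finset.univ : Finset {c // ¬ ℓ i c = l})), add_zero]
  exact fun c _ => h c c.2

variable (k ℓ) in
/-- The residues of the diagonal blocks. -/
def residueHom : blockTriOrder k ℓ →+* ResidueBlocks k ℓ where
  toFun X ω := Matrix.of fun a b => (X.1 ω.1 a.1 b.1).coeff 0
  map_one' := by
    ext ω a b
    change ((1 : Matrix (Fin (s ω.1)) (Fin (s ω.1)) (LaurentSeries k)) a.1 b.1).coeff 0 =
      (1 : Matrix (LevelFiber ℓ ω) (LevelFiber ℓ ω) k) a b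
    by_cases h : a = b
    · rw [h, Matrix.one_apply_eq, Matrix.one_apply_eq, HahnSeries.coeff_one, if_pos rfl]
    · rw [Matrix.one_apply_ne h, Matrix.one_apply_ne fun h' => h (Subtype.ext h')]
      rfl
  map_mul' := by
    rintro ⟨X, hX⟩ ⟨Y, hY⟩
    ext ⟨i, l⟩ ⟨a, ha⟩ ⟨b, hb⟩
    change ((X * Y) i a b).coeff 0 = _
    rw [coeff_zero_mul_apply hX.ordGE_zero hY.ordGE_zero, sum_levelFiber (l := l)]
    · rw [Pi.mul_apply, Matrix.mul_apply]
      rfl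
    · intro c hc
      -- An index c of another level makes one of the two factors an entry strictly above the block
      -- diagonal.
      rcases lt_or_gt_of_ne hc with h | h
      · rw [hY.coeff_zero (h.trans_eq hb.symm), mul_zero]
      · rw [hX.coeff_zero (ha.trans_lt h), zero_mul]
  map_zero' := by ext; rfl
  map_add' _ _ := by ext; rfl

theorem residueHom_apply (X : blockTriOrder k ℓ) (ω : Σ i, Fin (r i)) (a b : LevelFiber ℓ ω) :
    residueHom k ℓ X ω a b = (X.1 ω.1 a.1 b.1).coeff 0 := rfl

/-- Lift by constant block diagonal matrices. -/
theorem residueHom_surjective : Function.Surjective (residueHom k ℓ) := by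
  intro Y
  let X : ∀ i, Matrix (Fin (s i)) (Fin (s i)) (LaurentSeries k) := fun i => Matrix.of fun a b =>
    if h : ℓ i b = ℓ i a then HahnSeries.C (Y ⟨i, ℓ i a⟩ ⟨a, rfl⟩ ⟨b, h⟩) else 0
  have hX : IsBlockTri ℓ X := by
    refine isBlockTri_iff.mpr ⟨fun i a b => ?_, fun i a b hab => ?_⟩
    · simp only [X, Matrix.of_apply]
      split_ifs
      · rw [← PowerSeries.coe_C, ← LaurentSeries.coe_algebraMap]
        exact ordGE_algebraMap _
      · exact ordGE_zero 0
    · simp [X, hab.ne']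
  refine ⟨⟨X, hX⟩, ?_⟩
  have key : ∀ i l a b (ha : ℓ i a = l) (hb : ℓ i b = l),
      (X i a b).coeff 0 = Y ⟨i, l⟩ ⟨a, ha⟩ ⟨b, hb⟩ := by
    rintro i _ a b rfl hb
    simp [X, hb]
  ext ω a b
  exact key ω.1 ω.2 a.1 b.1 a.2 b.2

theorem residueHom_algebraMap_C (c : k) :
    residueHom k ℓ (algebraMap (PowerSeries k) _ (PowerSeries.C c)) = algebraMap k _ c := by
  ext ω a b
  rw [residueHom_apply, Pi.algebraMap_apply, Matrix.algebraMap_matrix_apply]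
  change ((algebraMap (PowerSeries k) (Matrix (Fin (s ω.1)) (Fin (s ω.1)) (LaurentSeries k))
    (PowerSeries.C c)) a.1 b.1).coeff 0 = _
  rw [Matrix.algebraMap_matrix_apply]
  by_cases h : a = b
  · rw [if_pos h, if_pos (congrArg _ h), coeff_zero_algebraMap]
    simp
  · rw [if_neg h, if_neg fun h' => h (Subtype.ext h')]
    rfl

/-- Modulo w the matrix is block triangular, so its determinant is the product of those of the
diagonal blocks and is nonzero. Hence X is invertible over k[[w]], and its inverse is again block
triangular modulo w. -/
theorem residueHom_isLocalHom : IsLocalHom (residueHom k ℓ) := by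
  refine ⟨fun ⟨X, hX⟩ hu => ?_⟩
  have hX : IsBlockTri ℓ X := hX
  choose M hM using fun i a b => exists_algebraMap_eq (hX.ordGE_zero i a b)
  let φ := algebraMap (PowerSeries k) (LaurentSeries k)
  let N : ∀ i, Matrix (Fin (s i)) (Fin (s i)) (PowerSeries k) := fun i => Matrix.of (M i)
  let N₀ : ∀ i, Matrix (Fin (s i)) (Fin (s i)) k := fun i =>
    PowerSeries.constantCoeff.mapMatrix (N i)
  have hN : ∀ i, φ.mapMatrix (N i) = X i := fun i => Matrix.ext fun a b => hM i a b
  have hcoeff : ∀ i a b, N₀ i a b = (X i a b).coeff 0 := by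
    intro i a b
    rw [← hM i a b, coeff_zero_algebraMap]
    rfl
  -- The entries above the diagonal vanish, opposite to the convention of `Matrix.BlockTriangular`;
  -- hence the dual order.
  have htri : ∀ i, (N₀ i).BlockTriangular (fun a => OrderDual.toDual (ℓ i a)) := by
    intro i a b hab
    rw [hcoeff]
    exact hX.coeff_zero (OrderDual.toDual_lt_toDual.mp hab)
  have hdet₀ : ∀ i, (N₀ i).det ≠ 0 := by
    intro i
    rw [(htri i).det_fintype]
    refine Finset.prod_ne_zero_iff.mpr fun l _ => ?_
    have h1 : IsUnit (residueHom k ℓ ⟨X, hX⟩ ⟨i, OrderDual.ofDual l⟩) := (Pi.isUnit_iff.mp hu) _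
    rw [Matrix.isUnit_iff_isUnit_det] at h1
    have h2 : (N₀ i).toSquareBlock (fun a => OrderDual.toDual (ℓ i a)) l =
        residueHom k ℓ ⟨X, hX⟩ ⟨i, OrderDual.ofDual l⟩ := by
      ext a b
      exact hcoeff i a.1 b.1
    rw [← h2] at h1
    exact h1.ne_zero
  have hdet : ∀ i, IsUnit (N i).det := by
    intro i
    rw [PowerSeries.isUnit_iff_constantCoeff, RingHom.map_det]
    exact (hdet₀ i).isUnit
  let Y : ∀ i, Matrix (Fin (s i)) (Fin (s i)) (LaurentSeries k) := fun i => φ.mapMatrix (N i)⁻¹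
  have hY : IsBlockTri ℓ Y := by
    refine isBlockTri_iff.mpr ⟨fun i a b => ordGE_algebraMap _, fun i a b hab => ?_⟩
    have hinv : (PowerSeries.constantCoeff.mapMatrix (N i)⁻¹) = (N₀ i)⁻¹ := by
      refine (Matrix.inv_eq_right_inv ?_).symm
      change PowerSeries.constantCoeff.mapMatrix (N i) * _ = _
      rw [← map_mul, Matrix.mul_nonsing_inv _ (hdet i), map_one]
    have h1 : (Y i a b).coeff 0 = (N₀ i)⁻¹ a b := by
      rw [← hinv]
      exact coeff_zero_algebraMap _
    rw [h1]
    let := Matrix.invertibleOfIsUnitDet (N₀ i) (hdet₀ i).isUnit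
    exact Matrix.blockTriangular_inv_of_blockTriangular (htri i)
      (OrderDual.toDual_lt_toDual.mpr hab)
  have hXY : X * Y = 1 := by
    ext1 i
    rw [Pi.mul_apply, ← hN, ← map_mul, Matrix.mul_nonsing_inv _ (hdet i), map_one, Pi.one_apply]
  have hYX : Y * X = 1 := by
    ext1 i
    rw [Pi.mul_apply, ← hN, ← map_mul, Matrix.nonsing_inv_mul _ (hdet i), map_one, Pi.one_apply]
  exact ⟨⟨⟨X, hX⟩, ⟨Y, hY⟩, Subtype.ext hXY, Subtype.ext hYX⟩, rfl⟩

end Residue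

/-! ### Radicals and the semisimple image of A. -/

section Radical

/-- A surjection sends the radical into that of a semisimple ring, which is zero. Conversely, y x +
1 maps to 1 for x in the kernel, so it is a unit because ρ is local. -/
theorem Ring.jacobson_eq_ker {H B : Type*} [Ring H] [Ring B] [IsSemisimpleRing B] (ρ : H →+* B)
    (hρ : Function.Surjective ρ) (hloc : IsLocalHom ρ) : Ring.jacobson H = RingHom.ker ρ := by
  apply le_antisymm
  · intro x hx
    have : RingHomSurjective ρ := ⟨hρ⟩
    have h1 := Ring.le_comap_jacobson ρ hx
    rw [IsSemisimpleRing.jacobson_eq_bot] at h1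
    exact h1
  · intro x hx
    rw [← Ideal.jacobson_bot, Ideal.mem_jacobson_iff]
    intro y
    have h1 : ρ (y * x + 1) = 1 := by
      rw [map_add, map_mul, (RingHom.mem_ker).mp hx, mul_zero, zero_add, map_one]
    obtain ⟨z, hz⟩ := hloc.map_nonunit (y * x + 1) (h1 ▸ isUnit_one)
    refine ⟨z⁻¹.val, ?_⟩
    have h2 : z⁻¹.val * (y * x + 1) = 1 := by rw [← hz, Units.inv_mul]
    rw [mul_add, mul_one, ← mul_assoc] at h2
    rw [h2, sub_self]
    exact Ideal.zero_mem _

end Radical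

/-- The kernel of A → C is the preimage of rad H, which is rad A. So C has zero radical, and it is
Artinian because it is finite-dimensional over k. -/
theorem isSemisimpleRing_of_image_of_jacobson_eq {k A H B : Type*} [Field k] [Ring A] [Ring H]
    [Ring B] [Algebra k B] [FiniteDimensional k B] [IsSemisimpleRing B] {f : A →+* H} {ρ : H →+* B}
    (hρ : Function.Surjective ρ) (hloc : IsLocalHom ρ)
    (hrad : ∀ a, f a ∈ Ring.jacobson H ↔ a ∈ Ring.jacobson A) (C : Subalgebra k B)
    (hC : ∀ b, b ∈ C ↔ ∃ a, ρ (f a) = b) : IsSemisimpleRing C := by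
  let π : A →+* C := (ρ.comp f).codRestrict C fun a => (hC _).mpr ⟨a, rfl⟩
  have hπ : Function.Surjective π := by
    rintro ⟨b, hb⟩
    obtain ⟨a, ha⟩ := (hC b).mp hb
    exact ⟨a, Subtype.ext ha⟩
  have hsurj : RingHomSurjective π := ⟨hπ⟩
  have hmem : ∀ a, π a = 0 ↔ f a ∈ Ring.jacobson H := by
    intro a
    rw [Ring.jacobson_eq_ker ρ hρ hloc, RingHom.mem_ker]
    exact Subtype.ext_iff
  have hker : RingHom.ker π ≤ Ring.jacobson A := fun a ha => (hrad a).mp ((hmem a).mp ha)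
  have hjac : Ring.jacobson C = ⊥ := by
    rw [eq_bot_iff]
    intro c hc
    rw [← Ring.map_jacobson_of_ker_le hker] at hc
    obtain ⟨a, ha, rfl⟩ := hc
    exact (hmem a).mpr ((hrad a).mpr ha)
  have : IsArtinianRing C := IsArtinianRing.of_finite k C
  exact IsArtinianRing.isSemisimpleRing_iff_jacobson.mpr hjac

/-! ### Representations of products of matrix algebras. -/

section BlockDiagonalForm

variable {k : Type*} [Field k] {T : Type} {m : T → ℕ}

/-- The entries of a tuple of matrices, indexed by natural numbers. -/
def natEntry (x : ∀ τ, Matrix (Fin (m τ)) (Fin (m τ)) k) (τ : T) (p q : ℕ) : k :=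
  if h : p < m τ ∧ q < m τ then x τ ⟨p, h.1⟩ ⟨q, h.2⟩ else 0

theorem natEntry_fin (x : ∀ τ, Matrix (Fin (m τ)) (Fin (m τ)) k) (τ : T) (p q : Fin (m τ)) :
    natEntry x τ p q = x τ p q := by
  simp [natEntry]

variable [Fintype T] [DecidableEq T]

/-- A representation of a product of matrix algebras is a direct sum of standard column
representations. -/
theorem exists_basis_of_pi_matrix (hm : ∀ τ, 0 < m τ) {V : Type*} [AddCommGroup V] [Module k V]
    [FiniteDimensional k V]
    (ρ : (∀ τ, Matrix (Fin (m τ)) (Fin (m τ)) k) →ₐ[k] Module.End k V) :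
    ∃ (E : Type) (_ : Fintype E) (lab : E → T) (v : Module.Basis (Σ z : E, Fin (m (lab z))) k V),
      ∀ x z q, ρ x (v ⟨z, q⟩) = ∑ p, x (lab z) p q • v ⟨z, p⟩ := by
  classical
  let o : ∀ τ, Fin (m τ) := fun τ => ⟨0, hm τ⟩
  let U : ∀ τ, Fin (m τ) → Fin (m τ) → ∀ τ, Matrix (Fin (m τ)) (Fin (m τ)) k := fun τ p q =>
    Pi.single τ (Matrix.single p q 1)
  have hU : ∀ τ p q r, U τ p q * U τ q r = U τ p r := by
    intro τ p q r
    simp only [U]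
    rw [← Pi.single_mul, Matrix.single_mul_single_same, one_mul]
  have hU1 : ∀ τ p q q' r, q ≠ q' → U τ p q * U τ q' r = 0 := by
    intro τ p q q' r h
    simp only [U]
    rw [← Pi.single_mul, Matrix.single_mul_single_of_ne _ _ _ _ h, Pi.single_zero]
  have hU2 : ∀ τ τ' p q p' q', τ ≠ τ' → U τ p q * U τ' p' q' = 0 := by
    intro τ τ' p q p' q' h
    ext1 σ
    simp only [U, Pi.mul_apply, Pi.zero_apply]
    by_cases h1 : σ = τ
    · subst h1
      rw [Pi.single_eq_of_ne h, mul_zero]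
    · rw [Pi.single_eq_of_ne h1, zero_mul]
  have hxU : ∀ x τ q r, x * U τ q r = ∑ p, x τ p q • U τ p r := by
    intro x τ q r
    ext1 σ
    simp only [U, Pi.mul_apply, Finset.sum_apply, Pi.smul_apply]
    by_cases h1 : σ = τ
    · subst h1
      ext a b
      simp [Matrix.mul_apply, Matrix.sum_apply, Matrix.single_apply, ite_and]
    · simp [h1]
  have hUsum : ∑ τ, ∑ p, U τ p p = 1 := by
    ext1 σ
    simp only [Finset.sum_apply, U]
    rw [Finset.sum_eq_single σ]
    · simp only [Pi.single_eq_same]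
      ext a b
      simp [Matrix.sum_apply, Matrix.single_apply, Matrix.one_apply, ite_and]
    · intro τ _ h
      simp [Pi.single_eq_of_ne h.symm]
    · simp
  -- The image of one primitive idempotent per factor is the multiplicity space of that factor; its
  -- basis vectors index the constituents.
  let W : T → Submodule k V := fun τ => LinearMap.range (ρ (U τ (o τ) (o τ)))
  have hW : ∀ τ, ∀ w ∈ W τ, ρ (U τ (o τ) (o τ)) w = w := by
    rintro τ _ ⟨w, rfl⟩
    rw [← Module.End.mul_apply, ← map_mul, hU]
  let b : ∀ τ, Module.Basis (Fin (Module.finrank k (W τ))) k (W τ) := fun τ =>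
    Module.finBasis k (W τ)
  let E := Σ τ, Fin (Module.finrank k (W τ))
  let lab : E → T := Sigma.fst
  -- The matrix units of the distinguished column carry a basis vector of W τ to a full standard
  -- column.
  let v : (Σ z : E, Fin (m (lab z))) → V := fun i => ρ (U i.1.1 i.2 (o i.1.1)) (b i.1.1 i.1.2)
  have hact : ∀ x z q, ρ x (v ⟨z, q⟩) = ∑ p, x (lab z) p q • v ⟨z, p⟩ := by
    intro x z q
    simp only [v]
    rw [← Module.End.mul_apply, ← map_mul, hxU, map_sum, LinearMap.sum_apply]
    simp only [map_smul, LinearMap.smul_apply]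
    rfl
  have hsame : ∀ τ (y : Fin (Module.finrank k (W τ))) p,
      ρ (U τ (o τ) p) (v ⟨⟨τ, y⟩, p⟩) = b τ y := by
    intro τ y p
    simp only [v]
    rw [← Module.End.mul_apply, ← map_mul, hU, hW _ _ (b τ y).2]
  have hdiff : ∀ τ p z q, (¬ ∃ y, (⟨z, q⟩ : Σ z : E, Fin (m (lab z))) = ⟨⟨τ, y⟩, p⟩) →
      ρ (U τ (o τ) p) (v ⟨z, q⟩) = 0 := by
    rintro τ p ⟨τ', y⟩ q h
    simp only [v]
    rw [← Module.End.mul_apply, ← map_mul]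
    by_cases h1 : τ = τ'
    · subst h1
      rw [hU1 _ _ _ _ _ (fun h2 => h ⟨y, by rw [h2]⟩), map_zero, LinearMap.zero_apply]
    · rw [hU2 _ _ _ _ _ _ h1, map_zero, LinearMap.zero_apply]
  -- Applying U τ o p to a relation retains only the vectors with label τ and position p and sends
  -- them to the basis of W τ.
  have hli : LinearIndependent k v := by
    rw [Fintype.linearIndependent_iff]
    rintro g hg ⟨⟨τ, y⟩, p⟩
    have h1 := congrArg (ρ (U τ (o τ) p)) hg
    rw [map_zero, map_sum] at h1
    have h2 : ∑ y, g ⟨⟨τ, y⟩, p⟩ • b τ y = 0 := by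
      apply Subtype.ext
      rw [Submodule.coe_zero, ← h1, AddSubmonoidClass.coe_finsetSum]
      refine Finset.sum_bij_ne_zero (fun y _ _ => ⟨⟨τ, y⟩, p⟩) ?_ ?_ ?_ ?_
      · intros; exact Finset.mem_univ _
      · intro y₁ _ _ y₂ _ _ h
        exact eq_of_heq (Sigma.mk.inj_iff.mp (congrArg Sigma.fst h)).2
      · rintro ⟨z, q⟩ _ hne
        by_contra hcon
        apply hne
        rw [map_smul, hdiff τ p z q, smul_zero]
        rintro ⟨y, hy⟩
        refine hcon ⟨y, Finset.mem_univ _, ?_, hy.symm⟩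
        rw [hy, map_smul, hsame] at hne
        exact hne
      · intro y _ _
        rw [map_smul, hsame]
        rfl
    exact Fintype.linearIndependent_iff.mp (b τ).linearIndependent _ h2 y
  have hspan : ⊤ ≤ Submodule.span k (Set.range v) := by
    intro u _
    -- Each summand factors through W τ because U τ p p = U τ p o · U τ o p.
    have h1 : u = ∑ τ, ∑ p, ρ (U τ p p) u := by
      conv_lhs => rw [← Module.End.one_apply (R := k) u, ← map_one ρ, ← hUsum]
      simp [map_sum, LinearMap.sum_apply]
    rw [h1]
    refine Submodule.sum_mem _ fun τ _ => Submodule.sum_mem _ fun p _ => ?_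
    have hw : ρ (U τ (o τ) p) u ∈ W τ :=
      ⟨ρ (U τ (o τ) p) u, by rw [← Module.End.mul_apply, ← map_mul, hU]⟩
    have h2 := congrArg Subtype.val ((b τ).sum_repr ⟨_, hw⟩)
    rw [AddSubmonoidClass.coe_finsetSum] at h2
    change _ = ρ (U τ (o τ) p) u at h2
    rw [← hU τ p (o τ) p, map_mul, Module.End.mul_apply, ← h2, map_sum]
    refine Submodule.sum_mem _ fun y _ => ?_
    rw [Submodule.coe_smul, map_smul]
    exact Submodule.smul_mem _ _ (Submodule.subset_span ⟨⟨⟨τ, y⟩, p⟩, rfl⟩)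
  refine ⟨E, inferInstance, lab, Module.Basis.mk hli hspan, fun x z q => ?_⟩
  simp only [Module.Basis.mk_apply]
  exact hact x z q

/-- The columns of g are an adapted basis of the column space, renumbered by F; e records the
constituent and the position of each basis vector. -/
theorem exists_conj_blockDiagonal (hm : ∀ τ, 0 < m τ) {F : Type*} [Fintype F] [DecidableEq F]
    (ρ : (∀ τ, Matrix (Fin (m τ)) (Fin (m τ)) k) →ₐ[k] Matrix F F k) :
    ∃ (E : Type) (_ : Fintype E) (_ : DecidableEq E) (lab : E → T)
      (e : F ≃ Σ z : E, Fin (m (lab z))) (g : (Matrix F F k)ˣ), ∀ x a b,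
      (g⁻¹.val * ρ x * g.val) a b =
        if (e a).1 = (e b).1 then natEntry x (lab (e a).1) (e a).2 (e b).2 else 0 := by
  classical
  obtain ⟨E, hE, lab, v, hv⟩ := exists_basis_of_pi_matrix hm
    ((Matrix.toLinAlgEquiv' : Matrix F F k ≃ₐ[k] _).toAlgHom.comp ρ)
  let e : F ≃ Σ z : E, Fin (m (lab z)) := (Pi.basisFun k F).indexEquiv v
  let w := v.reindex e.symm
  let G := (Pi.basisFun k F).toMatrix w
  let G' := w.toMatrix (Pi.basisFun k F)
  have hGG' : G * G' = 1 := (Pi.basisFun k F).toMatrix_mul_toMatrix_flip w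
  have hG'G : G' * G = 1 := w.toMatrix_mul_toMatrix_flip (Pi.basisFun k F)
  refine ⟨E, hE, inferInstance, lab, e, ⟨G, G', hGG', hG'G⟩, fun x a b => ?_⟩
  let D : Matrix F F k := Matrix.of fun a b =>
    if (e a).1 = (e b).1 then natEntry x (lab (e a).1) (e a).2 (e b).2 else 0
  have key : ρ x * G = G * D := by
    ext a b
    have h1 : (ρ x * G) a b = (ρ x).mulVec (v (e b)) a := by
      simp [G, w, Matrix.mul_apply, Matrix.mulVec, dotProduct, Module.Basis.toMatrix_apply]
    have h2 : (ρ x).mulVec (v (e b)) = ∑ p, x (lab (e b).1) p (e b).2 • v ⟨(e b).1, p⟩ :=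
      hv x (e b).1 (e b).2
    have hD : ∀ i, D (e.symm i) b =
        if i.1 = (e b).1 then natEntry x (lab i.1) i.2 (e b).2 else 0 := by
      intro i
      simp only [D, Matrix.of_apply]
      rw [e.apply_symm_apply]
    rw [h1, h2, Matrix.mul_apply, ← e.symm.sum_comp, Fintype.sum_sigma,
      Finset.sum_eq_single (e b).1]
    · rw [Finset.sum_apply]
      refine Finset.sum_congr rfl fun p _ => ?_
      rw [hD, if_pos rfl, natEntry_fin]
      simp [G, w, Module.Basis.toMatrix_apply, mul_comm]
    · intro z _ hz
      refine Finset.sum_eq_zero fun p _ => ?_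
      rw [hD, if_neg hz, mul_zero]
    · simp
  rw [Units.inv_mk]
  change (G' * ρ x * G) a b = D a b
  rw [mul_assoc, key, ← mul_assoc, hG'G, one_mul]

end BlockDiagonalForm

/-! ### Simple column modules. -/

section ColumnModule

variable {A k n : Type*} [Ring A] [Field k] [Fintype n] [DecidableEq n]

/-- The column space `kⁿ`, on which `A` acts through a homomorphism to the matrix algebra. -/
def ColumnModule (_φ : A →+* Matrix n n k) : Type _ := n → k

variable (φ : A →+* Matrix n n k)

instance : AddCommGroup (ColumnModule φ) := inferInstanceAs (AddCommGroup (n → k))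

instance : Module A (ColumnModule φ) :=
  Module.compHom (n → k)
    ((Matrix.toLinAlgEquiv' : Matrix n n k ≃ₐ[k] _).toRingEquiv.toRingHom.comp φ)

theorem ColumnModule.smul_apply (a : A) (u : ColumnModule φ) (x : n) :
    (a • u) x = ∑ y, φ a x y * u y := rfl

theorem ColumnModule.isSimpleModule [Nonempty n] (hφ : Function.Surjective φ) :
    IsSimpleModule A (ColumnModule φ) := by
  rw [isSimpleModule_iff_toSpanSingleton_surjective]
  refine ⟨inferInstanceAs (Nontrivial (n → k)), fun u hu w => ?_⟩
  obtain ⟨x, hx⟩ : ∃ x, u x ≠ 0 := Function.ne_iff.mp hu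
  -- A matrix with a single nonzero column, at a place where u does not vanish, sends u to w.
  obtain ⟨a, ha⟩ := hφ (Matrix.of fun y z => if z = x then w y * (u x)⁻¹ else 0)
  refine ⟨a, ?_⟩
  funext y
  rw [LinearMap.toSpanSingleton_apply, ColumnModule.smul_apply, ha]
  simp [hx]

end ColumnModule

/-! ### A lower bound for the length of induced modules. -/

section InducedLength

variable {k A H : Type u} [Field k] [Ring A] [Ring H] {f : A →+* H} {T : Type} {m : T → ℕ}
  {Ω : Type} {F : Ω → Type} {E : Ω → Type}
  {lab : ∀ ω, E ω → T}

/-- The pairs of constituents of the same block, the first of which has label `τ`. -/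
abbrev ConstituentPair (lab : ∀ ω, E ω → T) (τ : T) : Type :=
  Σ ω, {z : E ω // lab ω z = τ} × E ω

/-- The position in the block `ω` of the `x`-th basis vector of a constituent with label `τ`. -/
def constituentPos (e : ∀ ω, F ω ≃ Σ z : E ω, Fin (m (lab ω z))) {ω : Ω} {τ : T}
    (z : {z : E ω // lab ω z = τ}) (x : Fin (m τ)) : F ω :=
  (e ω).symm ⟨z.1, Fin.cast (by rw [z.2]) x⟩

variable {e : ∀ ω, F ω ≃ Σ z : E ω, Fin (m (lab ω z))}

theorem constituentPos_inj {ω : Ω} {τ τ' : T} {z : {z : E ω // lab ω z = τ}}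
    {z' : {z : E ω // lab ω z = τ'}} {x : Fin (m τ)} {x' : Fin (m τ')}
    (h : constituentPos e z x = constituentPos e z' x') : z.1 = z'.1 ∧ (x : ℕ) = x' := by
  have h1 := (e ω).symm.injective h
  obtain ⟨z, rfl⟩ := z
  obtain ⟨z', rfl⟩ := z'
  obtain ⟨rfl, h2⟩ := Sigma.mk.inj_iff.mp h1
  exact ⟨rfl, by rw [show x = x' by simpa using h2]⟩

variable [∀ ω, Fintype (F ω)] [∀ ω, Fintype (E ω)] [∀ ω, DecidableEq (E ω)]

/-- A column of a block diagonal matrix is supported on its own constituent, where its entries are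
those of x. -/
theorem sum_mul_blockDiagonal {ω : Ω} {X : Matrix (F ω) (F ω) k}
    {x : ∀ τ, Matrix (Fin (m τ)) (Fin (m τ)) k}
    (hX : ∀ a b, X a b = if (e ω a).1 = (e ω b).1 then
      natEntry x (lab ω (e ω a).1) (e ω a).2 (e ω b).2 else 0)
    {τ : T} (z : {z : E ω // lab ω z = τ}) (q : Fin (m τ)) (c : F ω → k) :
    ∑ j, c j * X j (constituentPos e z q) = ∑ p, c (constituentPos e z p) * x τ p q := by
  obtain ⟨z, rfl⟩ := z
  rw [← (e ω).symm.sum_comp, Fintype.sum_sigma, Finset.sum_eq_single z]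
  · refine Finset.sum_congr rfl fun p _ => ?_
    rw [hX, constituentPos, Equiv.apply_symm_apply, Equiv.apply_symm_apply, if_pos rfl]
    simp [natEntry_fin, constituentPos]
  · intro z' _ h
    refine Finset.sum_eq_zero fun p _ => ?_
    rw [hX, constituentPos, Equiv.apply_symm_apply, Equiv.apply_symm_apply, if_neg h, mul_zero]
  · simp

theorem sum_blockDiagonal_mul {ω : Ω} {X : Matrix (F ω) (F ω) k}
    {x : ∀ τ, Matrix (Fin (m τ)) (Fin (m τ)) k}
    (hX : ∀ a b, X a b = if (e ω a).1 = (e ω b).1 then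
      natEntry x (lab ω (e ω a).1) (e ω a).2 (e ω b).2 else 0)
    {τ : T} (z : {z : E ω // lab ω z = τ}) (p : Fin (m τ)) (c : F ω → k) :
    ∑ j, X (constituentPos e z p) j * c j = ∑ q, x τ p q * c (constituentPos e z q) := by
  obtain ⟨z, rfl⟩ := z
  rw [← (e ω).symm.sum_comp, Fintype.sum_sigma, Finset.sum_eq_single z]
  · refine Finset.sum_congr rfl fun q _ => ?_
    rw [hX, constituentPos, Equiv.apply_symm_apply, Equiv.apply_symm_apply, if_pos rfl]
    simp [natEntry_fin, constituentPos]
  · intro z' _ h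
    refine Finset.sum_eq_zero fun p _ => ?_
    rw [hX, constituentPos, Equiv.apply_symm_apply, Equiv.apply_symm_apply, if_neg h.symm, zero_mul]
  · simp

open TensorProduct in
/-- If `H → ∏_ω Mat(F ω)` is surjective and the restriction to `A` of each block is a direct sum of
column modules, then the length of the module induced from the column module with label `τ` is at
least the number of pairs of constituents of the same block, the first of which has label `τ`. -/
theorem card_constituentPair_le_inducedLength [∀ ω, DecidableEq (F ω)] [Fintype Ω]
    [DecidableEq Ω] [DecidableEq T] (hm : ∀ τ, 0 < m τ) (ρ : H →+* ∀ ω, Matrix (F ω) (F ω) k)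
    (hρ : Function.Surjective ρ)
    (θ : A →+* ∀ τ, Matrix (Fin (m τ)) (Fin (m τ)) k)
    (hρθ : ∀ a ω i j, ρ (f a) ω i j = if (e ω i).1 = (e ω j).1 then
      natEntry (θ a) (lab ω (e ω i).1) (e ω i).2 (e ω j).2 else 0) (τ : T) :
    (Fintype.card (ConstituentPair lab τ) : ℕ∞) ≤
      inducedLength f (ColumnModule ((Pi.evalRingHom _ τ).comp θ)) := by
  let U : T → Type u := fun τ => ColumnModule ((Pi.evalRingHom _ τ).comp θ)
  let Z := ConstituentPair lab τ
  -- The induced module is mapped onto a product with one column module for each pair (z, z'). The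
  -- component at the pair is the submatrix of ρ h with rows in z' and columns in z, applied to u.
  let M := ∀ ζ : Z, U (lab ζ.1 ζ.2.2)
  let end₂ : ∀ ζ : Z, {z : E ζ.1 // lab ζ.1 z = lab ζ.1 ζ.2.2} := fun ζ => ⟨ζ.2.2, rfl⟩
  let β : H → U τ → M := fun h u ζ x =>
    ∑ y, ρ h ζ.1 (constituentPos e (end₂ ζ) x) (constituentPos e ζ.2.1 y) * u y
  have hβ : ∀ h u ζ x, β h u ζ x =
    ∑ y, ρ h ζ.1 (constituentPos e (end₂ ζ) x) (constituentPos e ζ.2.1 y) * u y :=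
      fun _ _ _ _ => rfl
  have hβr : ∀ h u v, β h (u + v) = β h u + β h v := by
    intro h u v
    funext ζ x
    have h1 : (β h u + β h v) ζ x = β h u ζ x + β h v ζ x := rfl
    rw [h1, hβ, hβ, hβ, ← Finset.sum_add_distrib]
    exact Finset.sum_congr rfl fun y _ => mul_add _ _ _
  have hβl : ∀ h h' u, β (h + h') u = β h u + β h' u := by
    intro h h' u
    funext ζ x
    have h1 : (β h u + β h' u) ζ x = β h u ζ x + β h' u ζ x := rfl
    rw [h1, hβ, hβ, hβ, ← Finset.sum_add_distrib]
    refine Finset.sum_congr rfl fun y _ => ?_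
    rw [map_add, ← add_mul]
    rfl
  let β' : H →+ U τ →+ M := AddMonoidHom.mk' (fun h => AddMonoidHom.mk' (β h) (hβr h))
    fun h h' => AddMonoidHom.ext (hβl h h')
  let Φ : H ⊗[ℤ] U τ →ₗ[ℤ] M := (TensorProduct.liftAddHom β' fun r h u => by
    rw [map_zsmul, map_zsmul, AddMonoidHom.smul_apply]).toIntLinearMap
  have hΦ : ∀ h u, Φ (h ⊗ₜ u) = β h u := fun _ _ => rfl
  have hbal : ∀ h a u, β (h * f a) u = β h (a • u) := by
    intro h a u
    funext ζ x
    rw [hβ, hβ]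
    have h1 : ∀ y, (a • u) y = ∑ y', θ a τ y y' * u y' := fun y => rfl
    simp only [h1, map_mul, Pi.mul_apply, Matrix.mul_apply,
      sum_mul_blockDiagonal (hρθ a ζ.1), Finset.sum_mul, Finset.mul_sum]
    rw [Finset.sum_comm]
    simp only [mul_assoc]
  have hlin : ∀ a h u, β (f a * h) u = a • β h u := by
    intro a h u
    funext ζ x
    have h1 : (a • β h u) ζ x = ∑ y', θ a _ x y' * β h u ζ y' := rfl
    rw [h1]
    simp only [hβ, map_mul, Pi.mul_apply, Matrix.mul_apply, sum_blockDiagonal_mul (hρθ a ζ.1),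
      Finset.sum_mul, Finset.mul_sum]
    rw [Finset.sum_comm]
    simp only [mul_assoc]
  have hker : (balancedRelations f (U τ)).restrictScalars ℤ ≤ LinearMap.ker Φ := by
    intro z hz
    -- The relations span an H-submodule whereas Φ is only additive, so the induction carries an
    -- arbitrary left factor h.
    have key : ∀ h : H, Φ (h • z) = 0 := by
      refine Submodule.span_induction (p := fun z _ => ∀ h : H, Φ (h • z) = 0) ?_ ?_ ?_ ?_ hz
      · rintro _ ⟨h, a, u, rfl⟩ h'
        rw [smul_sub, TensorProduct.smul_tmul', TensorProduct.smul_tmul', map_sub, hΦ, hΦ,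
          smul_eq_mul, smul_eq_mul, ← mul_assoc, hbal, sub_self]
      · intro h
        rw [smul_zero, map_zero]
      · intro x y _ _ hx hy h
        rw [smul_add, map_add, hx, hy, add_zero]
      · intro h x _ hx h'
        rw [smul_smul]
        exact hx _
    have := key 1
    rwa [one_smul] at this
  let Ψ : InducedModule f (U τ) →ₗ[ℤ] M := (Submodule.liftQ _ Φ hker).comp
    (Submodule.Quotient.restrictScalarsEquiv ℤ (balancedRelations f (U τ))).symm.toLinearMap
  have hΨ : ∀ z, Ψ (Submodule.Quotient.mk z) = Φ z := fun _ => rfl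
  let _ : Module A (InducedModule f (U τ)) := Module.compHom (InducedModule f (U τ)) f
  let Ψ' : InducedModule f (U τ) →ₗ[A] M :=
    { toFun := Ψ
      map_add' := map_add Ψ
      map_smul' := by
        intro a z
        obtain ⟨z, rfl⟩ := Submodule.Quotient.mk_surjective _ z
        change Ψ (Submodule.Quotient.mk (f a • z)) = a • Ψ (Submodule.Quotient.mk z)
        rw [hΨ, hΨ]
        induction z using TensorProduct.induction_on with
        | zero => rw [smul_zero, map_zero, smul_zero]
        | tmul h u => rw [TensorProduct.smul_tmul', hΦ, hΦ, smul_eq_mul, hlin]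
        | add x y hx hy => rw [smul_add, map_add, hx, hy, map_add, smul_add] }
  have hsingle : ∀ (ζ : Z) (w : U (lab ζ.1 ζ.2.2)), ∃ z, Ψ' z = Pi.single ζ w := by
    intro ζ w
    let o : Fin (m τ) := ⟨0, hm τ⟩
    -- Lift the matrix with the column w in the rows of z', at the first column of z; paired with
    -- the first basis vector of U τ, it has only the component ζ.
    obtain ⟨h, hh⟩ := hρ (Pi.single ζ.1 (∑ x, Matrix.single (constituentPos e (end₂ ζ) x)
      (constituentPos e ζ.2.1 o) (w x)))
    obtain ⟨u, hu⟩ : ∃ u : U τ, ∀ y, u y = if y = o then (1 : k) else 0 :=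
      ⟨fun y => if y = o then (1 : k) else 0, fun _ => rfl⟩
    refine ⟨Submodule.Quotient.mk (h ⊗ₜ u), ?_⟩
    change β h u = _
    funext ζ' x'
    rw [hβ, Finset.sum_eq_single o (fun y _ hy => by rw [hu, if_neg hy, mul_zero])
      (by simp), hu, if_pos rfl, mul_one, hh]
    by_cases h0 : ζ' = ζ
    · subst h0
      rw [Pi.single_eq_same, Pi.single_eq_same, Matrix.sum_apply, Finset.sum_eq_single x']
      · rw [Matrix.single_apply_same]
      · intro y _ hy
        rw [Matrix.single_apply_of_row_ne]
        intro h1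
        exact hy (Fin.ext (constituentPos_inj h1).2)
      · simp
    · rw [Pi.single_eq_of_ne h0]
      change _ = (0 : k)
      obtain ⟨ω, z, y⟩ := ζ
      obtain ⟨ω', z', y'⟩ := ζ'
      by_cases h1 : ω' = ω
      · subst h1
        rw [Pi.single_eq_same, Matrix.sum_apply]
        refine Finset.sum_eq_zero fun x _ => ?_
        rw [Matrix.single_apply, if_neg]
        rintro ⟨h2, h3⟩
        apply h0
        have h4 := (constituentPos_inj h2).1
        have h5 : z = z' := Subtype.ext (constituentPos_inj h3).1
        simp only [end₂] at h4
        rw [h5, h4]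
      · rw [Pi.single_eq_of_ne h1]
        rfl
  have hsurj : Function.Surjective Ψ' := by
    intro w
    choose z hz using fun ζ => hsingle ζ (w ζ)
    refine ⟨∑ ζ, z ζ, ?_⟩
    rw [map_sum]
    simp only [hz]
    exact Finset.univ_sum_single w
  have hle : Module.length A M ≤ Module.length A (InducedModule f (U τ)) :=
    Module.length_le_of_surjective Ψ' hsurj
  refine le_trans ?_ hle
  -- Each factor is nonzero and so contributes at least 1.
  rw [Module.length_pi_of_fintype, Fintype.card_eq_sum_ones, Nat.cast_sum]
  refine Finset.sum_le_sum fun ζ _ => ?_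
  have : Nonempty (Fin (m (lab ζ.1 ζ.2.2))) := ⟨⟨0, hm _⟩⟩
  have : Nontrivial (U (lab ζ.1 ζ.2.2)) :=
    inferInstanceAs (Nontrivial (Fin (m (lab ζ.1 ζ.2.2)) → k))
  rw [Nat.cast_one]
  exact Order.one_le_iff_pos.mpr Module.length_pos

end InducedLength

/-! ### From constituents to ties and weights. -/

section Combinatorics

variable {T : Type} {m : T → ℕ} {Ω : Type} {F E : Ω → Type} {lab : ∀ ω, E ω → T}

/-- At most two pairs of constituents have a first member with a given label. -/
def HasFewConstituentPairs (lab : ∀ ω, E ω → T) : Prop :=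
  ∀ (τ : T) (ζ₁ ζ₂ ζ₃ : ConstituentPair lab τ), ζ₁ = ζ₂ ∨ ζ₁ = ζ₃ ∨ ζ₂ = ζ₃

/-- Pair z₁ with each of the three constituents. -/
theorem HasFewConstituentPairs.eq_or_eq_or_eq (h : HasFewConstituentPairs lab)
    {ω : Ω} (z₁ z₂ z₃ : E ω) :
    z₁ = z₂ ∨ z₁ = z₃ ∨ z₂ = z₃ := by
  have := h (lab ω z₁) ⟨ω, ⟨z₁, rfl⟩, z₁⟩ ⟨ω, ⟨z₁, rfl⟩, z₂⟩ ⟨ω, ⟨z₁, rfl⟩, z₃⟩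
  simpa using this

/-- The pairs (z, y), (z, y') and (z', z') all start with the same label, and the last differs from
the other two. In particular, the labels within one block are distinct. -/
theorem HasFewConstituentPairs.subsingleton (h : HasFewConstituentPairs lab) {ω ω' : Ω} {z : E ω}
    {z' : E ω'}
    (hlab : lab ω z = lab ω' z') (hne : (⟨ω, z⟩ : Σ ω, E ω) ≠ ⟨ω', z'⟩) : Subsingleton (E ω) := by
  refine ⟨fun y y' => ?_⟩
  rcases h (lab ω z) ⟨ω, ⟨z, rfl⟩, y⟩ ⟨ω, ⟨z, rfl⟩, y'⟩ ⟨ω', ⟨z', hlab.symm⟩, z'⟩ with h1 | h1 | h1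
  · simpa using h1
  all_goals
    exact absurd (congrArg (fun ζ : ConstituentPair lab _ => (⟨ζ.1, ζ.2.1.1⟩ : Σ ω, E ω)) h1) hne

theorem HasFewConstituentPairs.three (h : HasFewConstituentPairs lab) {ω₁ ω₂ ω₃ : Ω}
    {z₁ : E ω₁} {z₂ : E ω₂} {z₃ : E ω₃}
    (h₁₂ : lab ω₁ z₁ = lab ω₂ z₂) (h₁₃ : lab ω₁ z₁ = lab ω₃ z₃) :
    ω₁ = ω₂ ∨ ω₁ = ω₃ ∨ ω₂ = ω₃ := by
  rcases h (lab ω₁ z₁) ⟨ω₁, ⟨z₁, rfl⟩, z₁⟩ ⟨ω₂, ⟨z₂, h₁₂.symm⟩, z₂⟩ ⟨ω₃, ⟨z₃, h₁₃.symm⟩, z₃⟩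
    with h1 | h1 | h1
  · exact Or.inl (congrArg Sigma.fst h1)
  · exact Or.inr (Or.inl (congrArg Sigma.fst h1))
  · exact Or.inr (Or.inr (congrArg Sigma.fst h1))

/-- Two different blocks are tied if they have constituents with the same label, and a block is
tied to itself if it has several constituents. -/
def HasFewConstituentPairs.tie (h : HasFewConstituentPairs lab) : TieRelation Ω where
  rel ω ω' := (ω = ω' ∧ ¬ Subsingleton (E ω)) ∨ (ω ≠ ω' ∧ ∃ z z', lab ω z = lab ω' z')
  symm := by
    rintro a b (⟨rfl, ha⟩ | ⟨hab, z, z', hz⟩)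
    · exact Or.inl ⟨rfl, ha⟩
    · exact Or.inr ⟨hab.symm, z', z, hz.symm⟩
  unique := by
    rintro a b c (⟨rfl, ha⟩ | ⟨hab, z, z', hz⟩) (⟨rfl, ha'⟩ | ⟨hac, y, y', hy⟩)
    · rfl
    · exact absurd (h.subsingleton hy fun h' => hac (congrArg Sigma.fst h')) ha
    · exact absurd (h.subsingleton hz fun h' => hab (congrArg Sigma.fst h')) ha'
    · have := h.subsingleton hz fun h' => hab (congrArg Sigma.fst h')
      obtain rfl := Subsingleton.elim z y
      exact ((h.three hz hy).resolve_left hab).resolve_left hac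

theorem HasFewConstituentPairs.tie_self (h : HasFewConstituentPairs lab) {ω : Ω} :
    h.tie.rel ω ω ↔ ¬ Subsingleton (E ω) := by
  simp [HasFewConstituentPairs.tie]

theorem HasFewConstituentPairs.tie_of_ne (h : HasFewConstituentPairs lab)
    {ω ω' : Ω} (hne : ω ≠ ω') :
    h.tie.rel ω ω' ↔ ∃ z z', lab ω z = lab ω' z' := by
  simp [HasFewConstituentPairs.tie, hne]

theorem HasFewConstituentPairs.subsingleton_of_tie (h : HasFewConstituentPairs lab)
    {ω ω' : Ω} (hne : ω ≠ ω')
    (ht : h.tie.rel ω ω') : Subsingleton (E ω) := by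
  obtain ⟨z, z', hz⟩ := (h.tie_of_ne hne).mp ht
  exact h.subsingleton hz fun h' => hne (congrArg Sigma.fst h')

/-- In a block tied to itself, z₀ and z₁ become the parts ω₊ and ω₋; in other blocks z₁ is a dummy.
-/
theorem HasFewConstituentPairs.exists_two (h : HasFewConstituentPairs lab) 
    (hne : ∀ ω, Nonempty (E ω)) :
    ∃ z₀ z₁ : ∀ ω, E ω, (∀ ω, ¬ Subsingleton (E ω) → z₁ ω ≠ z₀ ω) ∧
      ∀ ω z, z = z₀ ω ∨ z = z₁ ω := by
  have : ∀ ω, ∃ z₀ z₁ : E ω, (¬ Subsingleton (E ω) → z₁ ≠ z₀) ∧ ∀ z, z = z₀ ∨ z = z₁ := by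
    intro ω
    by_cases hs : Subsingleton (E ω)
    · obtain ⟨z⟩ := hne ω
      exact ⟨z, z, fun h' => absurd hs h', fun y => Or.inl (Subsingleton.elim _ _)⟩
    · obtain ⟨z₁, z₀, hz⟩ := not_subsingleton_iff_nontrivial.mp hs
      refine ⟨z₀, z₁, fun _ => hz, fun z => ?_⟩
      rcases h.eq_or_eq_or_eq z z₀ z₁ with h1 | h1 | h1
      · exact Or.inl h1
      · exact Or.inr h1
      · exact absurd h1.symm hz
  choose z₀ z₁ h1 h2 using this
  exact ⟨z₀, z₁, h1, h2⟩

/-- The gluing conditions on a tuple of matrices over the residue field: tied blocks agree, and the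
blocks tied to themselves are block diagonal. The position of a row within its block is recorded by
`β`. -/
def IsGlued {Ω : Type} {F : Ω → Type} {k : Type*} [Zero k] {tie : TieRelation Ω}
    (wt : WeightFunction tie) (β : ∀ ω, F ω → ℕ) (X : ∀ ω, Matrix (F ω) (F ω) k) : Prop :=
  (∀ ω ω', tie.rel ω ω' → ω ≠ ω' → ∀ a b a' b', β ω a = β ω' a' → β ω b = β ω' b' →
    X ω a b = X ω' a' b') ∧
  ∀ ω (ht : tie.rel ω ω) a b, ¬ (β ω a < wt.toFun (Sum.inr (⟨ω, ht⟩, true)) ↔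
    β ω b < wt.toFun (Sum.inr (⟨ω, ht⟩, true))) → X ω a b = 0

/-- Block diagonal tuples with prescribed labels are the tuples satisfying the gluing conditions of
a suitable datum. -/
theorem HasFewConstituentPairs.exists_datum (h : HasFewConstituentPairs lab)
    (e : ∀ ω, F ω ≃ Σ z : E ω, Fin (m (lab ω z)))
    [∀ ω, DecidableEq (E ω)] (hm : ∀ τ, 0 < m τ) (hne : ∀ ω, Nonempty (E ω))
    (hT : ∀ τ, ∃ ω z, lab ω z = τ) (k : Type u) [Field k] :
    ∃ (tie : TieRelation Ω) (wt : WeightFunction tie) (β : ∀ ω, F ω → ℕ),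
      (∀ ω, Function.Injective (β ω)) ∧ (∀ ω c, c < wt.weight ω ↔ ∃ a, β ω a = c) ∧
      ∀ X : ∀ ω, Matrix (F ω) (F ω) k,
        (∃ x : ∀ τ, Matrix (Fin (m τ)) (Fin (m τ)) k, ∀ ω a b, X ω a b =
          if (e ω a).1 = (e ω b).1 then natEntry x (lab ω (e ω a).1) (e ω a).2 (e ω b).2 else 0) ↔
        IsGlued wt β X := by
  obtain ⟨z₀, z₁, hz₁, hz⟩ := h.exists_two hne
  let w : h.tie.Split → ℕ
    | Sum.inl ω => m (lab ω.1 (z₀ ω.1))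
    | Sum.inr (ω, true) => m (lab ω.1 (z₀ ω.1))
    | Sum.inr (ω, false) => m (lab ω.1 (z₁ ω.1))
  let wt : WeightFunction h.tie :=
    { toFun := w
      pos := by
        rintro (ω | ⟨ω, _ | _⟩) <;> exact hm _
      tied := by
        rintro ⟨a, ha⟩ ⟨b, hb⟩ hab
        change m (lab a (z₀ a)) = m (lab b (z₀ b))
        by_cases hab' : a = b
        · rw [hab']
        · obtain ⟨z, z', hzz⟩ := (h.tie_of_ne hab').mp hab
          have := h.subsingleton_of_tie hab' hab
          have := h.subsingleton_of_tie (Ne.symm hab') (h.tie.symm _ _ hab)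
          rw [Subsingleton.elim (z₀ a) z, Subsingleton.elim (z₀ b) z', hzz] }
  -- The rows of z₀ are numbered first, so that ω₊ occupies the initial part of the stripe.
  let β : ∀ ω, F ω → ℕ := fun ω a =>
    if (e ω a).1 = z₀ ω then (e ω a).2 else m (lab ω (z₀ ω)) + (e ω a).2
  have hβ₀ : ∀ ω p, β ω ((e ω).symm ⟨z₀ ω, p⟩) = p := by
    intro ω p
    simp only [β]
    rw [Equiv.apply_symm_apply, if_pos rfl]
  have hβ₁ : ∀ ω z p, z ≠ z₀ ω → β ω ((e ω).symm ⟨z, p⟩) = m (lab ω (z₀ ω)) + p := by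
    intro ω z p hzz
    simp only [β]
    rw [Equiv.apply_symm_apply, if_neg hzz]
  have hplus : ∀ ω z p, β ω ((e ω).symm ⟨z, p⟩) < m (lab ω (z₀ ω)) ↔ z = z₀ ω := by
    intro ω z p
    by_cases hzz : z = z₀ ω
    · subst hzz
      rw [hβ₀]
      simp
    · rw [hβ₁ ω z p hzz]
      simp [hzz]
  have hβs : ∀ ω z p, Subsingleton (E ω) → β ω ((e ω).symm ⟨z, p⟩) = p := by
    intro ω z p hs
    obtain rfl := Subsingleton.elim z (z₀ ω)
    exact hβ₀ ω p
  have hsurj : ∀ ω a, ∃ z p, a = (e ω).symm ⟨z, p⟩ := fun ω a =>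
    ⟨(e ω a).1, (e ω a).2, ((e ω).symm_apply_apply a).symm⟩
  refine ⟨h.tie, wt, β, ?_, ?_, ?_⟩
  · intro ω a b hab
    obtain ⟨z, p, rfl⟩ := hsurj ω a
    obtain ⟨y, q, rfl⟩ := hsurj ω b
    have h1 := hplus ω z p
    rw [hab, hplus] at h1
    have hzy : z = y := by
      rcases hz ω z with h2 | h2 <;> rcases hz ω y with h3 | h3
      · rw [h2, h3]
      · rw [h1.mpr h2, h2]
      · rw [h1.mp h3, h3]
      · rw [h2, h3]
    subst hzy
    have hpq : p = q := by
      by_cases h2 : z = z₀ ω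
      · subst h2
        rw [hβ₀, hβ₀] at hab
        exact Fin.ext hab
      · rw [hβ₁ ω z p h2, hβ₁ ω z q h2] at hab
        exact Fin.ext (Nat.add_left_cancel hab)
    rw [hpq]
  · intro ω c
    by_cases hs : Subsingleton (E ω)
    · have hw : wt.weight ω = m (lab ω (z₀ ω)) := by
        rw [WeightFunction.weight, dif_neg (fun ht => h.tie_self.mp ht hs)]
      rw [hw]
      constructor
      · intro hc
        exact ⟨_, hβ₀ ω ⟨c, hc⟩⟩
      · rintro ⟨a, rfl⟩
        obtain ⟨z, p, rfl⟩ := hsurj ω a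
        exact (hplus ω z p).mpr (Subsingleton.elim _ _)
    · have hw : wt.weight ω = m (lab ω (z₀ ω)) + m (lab ω (z₁ ω)) := by
        rw [WeightFunction.weight, dif_pos (h.tie_self.mpr hs)]
      rw [hw]
      constructor
      · intro hc
        by_cases hc' : c < m (lab ω (z₀ ω))
        · exact ⟨_, hβ₀ ω ⟨c, hc'⟩⟩
        · refine ⟨_, (hβ₁ ω (z₁ ω) ⟨c - m (lab ω (z₀ ω)), by lia⟩ (hz₁ ω hs)).trans ?_⟩
          simp only
          lia
      · rintro ⟨a, rfl⟩
        obtain ⟨z, p, rfl⟩ := hsurj ω a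
        by_cases hzz : z = z₀ ω
        · exact ((hplus ω z p).mpr hzz).trans_le (Nat.le_add_right _ _)
        · rw [hβ₁ ω z p hzz]
          obtain rfl := (hz ω z).resolve_left hzz
          exact Nat.add_lt_add_left p.2 _
  · intro X
    constructor
    · rintro ⟨x, hx⟩
      refine ⟨fun ω ω' ht hωω' a b a' b' ha hb => ?_, fun ω ht a b hab => ?_⟩
      · have hs := h.subsingleton_of_tie hωω' ht
        have hs' := h.subsingleton_of_tie hωω'.symm (h.tie.symm _ _ ht)
        obtain ⟨y, y', hy⟩ := (h.tie_of_ne hωω').mp ht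
        obtain ⟨za, p, rfl⟩ := hsurj ω a
        obtain ⟨zb, q, rfl⟩ := hsurj ω b
        obtain ⟨za', p', rfl⟩ := hsurj ω' a'
        obtain ⟨zb', q', rfl⟩ := hsurj ω' b'
        obtain rfl := Subsingleton.elim za y
        obtain rfl := Subsingleton.elim zb za
        obtain rfl := Subsingleton.elim za' y'
        obtain rfl := Subsingleton.elim zb' za'
        rw [hβs _ _ _ hs, hβs _ _ _ hs'] at ha hb
        rw [hx, hx, (e ω).apply_symm_apply, (e ω).apply_symm_apply, (e ω').apply_symm_apply,
          (e ω').apply_symm_apply, if_pos rfl, if_pos rfl, ha, hb, hy]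
      · obtain ⟨z, p, rfl⟩ := hsurj ω a
        obtain ⟨y, q, rfl⟩ := hsurj ω b
        change ¬ (_ < m (lab ω (z₀ ω)) ↔ _ < m (lab ω (z₀ ω))) at hab
        rw [hplus, hplus] at hab
        rw [hx]
        simp only [Equiv.apply_symm_apply]
        rw [if_neg]
        rintro rfl
        exact hab Iff.rfl
    · rintro ⟨h1, h2⟩
      choose Ωt zt hzt using hT
      -- The component x τ is read off at one chosen constituent with label τ. Any other constituent
      -- with this label lies in a different block tied to the chosen one, where X has the same
      -- entries.
      refine ⟨fun τ => Matrix.of fun p q => X (Ωt τ) (constituentPos e ⟨zt τ, hzt τ⟩ p)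
        (constituentPos e ⟨zt τ, hzt τ⟩ q), fun ω a b => ?_⟩
      obtain ⟨z, p, rfl⟩ := hsurj ω a
      obtain ⟨y, q, rfl⟩ := hsurj ω b
      rw [(e ω).apply_symm_apply, (e ω).apply_symm_apply]
      split_ifs with hzy
      · subst hzy
        rw [natEntry_fin, Matrix.of_apply]
        have key : ∀ ω' z' (hz' : lab ω' z' = lab ω z),
            X ω' (constituentPos e ⟨z', hz'⟩ p) (constituentPos e ⟨z', hz'⟩ q) =
            X ω ((e ω).symm ⟨z, p⟩) ((e ω).symm ⟨z, q⟩) := by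
          intro ω' z' hz'
          by_cases hω : ω' = ω
          · subst hω
            by_cases hzz : z' = z
            · subst hzz
              rfl
            · have := h.subsingleton hz' fun h' => hzz (by simpa using h')
              exact absurd (Subsingleton.elim _ _) hzz
          · have ht := (h.tie_of_ne hω).mpr ⟨z', z, hz'⟩
            have hs := h.subsingleton_of_tie hω ht
            have hs' := h.subsingleton_of_tie (Ne.symm hω) (h.tie.symm _ _ ht)
            refine h1 ω' ω ht hω _ _ _ _ ?_ ?_ <;>
              rw [constituentPos, hβs _ _ _ hs, hβs _ _ _ hs'] <;> rfl
        exact (key _ _ _).symm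
      · have hs : ¬ Subsingleton (E ω) := fun hs => hzy (Subsingleton.elim _ _)
        -- Distinct constituents of a block are z₀ and z₁ in some order, so exactly one of the two
        -- rows lies in the plus part.
        refine h2 ω (h.tie_self.mpr hs) _ _ ?_
        change ¬ (_ < m (lab ω (z₀ ω)) ↔ _ < m (lab ω (z₀ ω)))
        rw [hplus, hplus]
        intro h3
        rcases hz ω z with h4 | h4
        · exact hzy (h4.trans (h3.mp h4).symm)
        · rcases hz ω y with h5 | h5
          · exact hzy ((h3.mpr h5).trans h5.symm)
          · exact hzy (h4.trans h5.symm)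

end Combinatorics

/-! ### The cyclic datum and its markings. -/

section CyclicDatum

variable {t : ℕ} {r : Fin t → ℕ}

/-- The permutation of `⨆ i, ℤ / r i` which adds one in each component. -/
def cyclicShift (hr : ∀ i, 0 < r i) : Equiv.Perm (Σ i, Fin (r i)) :=
  Equiv.sigmaCongrRight fun i =>
    have : NeZero (r i) := ⟨(hr i).ne'⟩
    Equiv.addRight 1

theorem cyclicShift_pow (hr : ∀ i, 0 < r i) (n : ℕ) (i : Fin t) (c : Fin (r i)) :
    (cyclicShift hr ^ n) ⟨i, c⟩ = ⟨i, ⟨(c + n) % r i, Nat.mod_lt _ (hr i)⟩⟩ := by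
  induction n with
  | zero => simp [Nat.mod_eq_of_lt c.2]
  | succ n ih =>
    have : NeZero (r i) := ⟨(hr i).ne'⟩
    have hstep : ∀ c' : Fin (r i), cyclicShift hr ⟨i, c'⟩ = ⟨i, c' + 1⟩ := fun _ => rfl
    rw [pow_succ', Equiv.Perm.mul_apply, ih, hstep]
    congr 1
    ext
    rw [Fin.val_add, Fin.val_one', Nat.add_mod_mod, Nat.mod_add_mod, add_assoc]

theorem cyclicShift_pow_fst (hr : ∀ i, 0 < r i) (n : ℕ) (a : Σ i, Fin (r i)) :
    ((cyclicShift hr ^ n) a).1 = a.1 := by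
  obtain ⟨i, c⟩ := a
  rw [cyclicShift_pow]

/-- The datum with the cyclic permutations of `Fin (r i)`. -/
def cyclicDatum (hr : ∀ i, 0 < r i) {tie : TieRelation (Σ i, Fin (r i))}
    (wt : WeightFunction tie) : NodalDatum t where
  Ω := Σ i, Fin (r i)
  finite := inferInstance
  σ := cyclicShift hr
  tie := tie
  wt := wt
  cyc := Sigma.fst
  cyc_surjective i := ⟨⟨i, ⟨0, hr i⟩⟩, rfl⟩
  cyc_eq_iff := by
    intro a b
    constructor
    · rintro h
      obtain ⟨i, a⟩ := a
      obtain ⟨i', b⟩ := b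
      obtain rfl : i = i' := h
      refine ⟨((b + r i - a : ℕ) : ℤ), ?_⟩
      rw [zpow_natCast, cyclicShift_pow]
      congr 1
      ext
      have : (a : ℕ) + (b + r i - a) = b + r i := by lia
      simp only [this]
      rw [Nat.add_mod_right, Nat.mod_eq_of_lt b.2]
    · rintro ⟨n, hn⟩
      obtain ⟨n, rfl | rfl⟩ := n.eq_nat_or_neg
      · rw [zpow_natCast] at hn
        rw [← hn, cyclicShift_pow_fst]
      · rw [zpow_neg, zpow_natCast, Equiv.Perm.inv_eq_iff_eq] at hn
        rw [hn, cyclicShift_pow_fst]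

variable {hr : ∀ i, 0 < r i} {tie : TieRelation (Σ i, Fin (r i))} {wt : WeightFunction tie}
  (m : (cyclicDatum hr wt).Marking)

theorem cyclicDatum_cycleLength (i : Fin t) : m.cycleLength i = r i := by
  have : m.cycleLength i = Nat.card (Fin (r i)) := Nat.card_congr (Equiv.sigmaSubtype i)
  rw [this, Nat.card_fin]

theorem cyclicDatum_exists_pt : ∃ c : ∀ i, Fin (r i), ∀ i, m.pt i = ⟨i, c i⟩ := by
  have : ∀ i, ∃ c : Fin (r i), m.pt i = ⟨i, c⟩ := by
    intro i
    have h := m.cyc_pt i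
    generalize m.pt i = ω at h
    obtain ⟨i', c⟩ := ω
    obtain rfl : i' = i := h
    exact ⟨c, rfl⟩
  choose c hc using this
  exact ⟨c, hc⟩

/-- The stripe j has level c + j modulo r. The levels below c are those that wrap around; moving
them behind the others changes the indicator of < by the coboundary of the indicator of these
levels, which a diagonal conjugation can absorb. -/
theorem cyclicDatum_exists_level : ∃ (c : ∀ i, Fin (r i))
    (lv : ∀ i, Fin (m.cycleLength i) ≃ Fin (r i)),
    (∀ i j, m.elt i j = ⟨i, lv i j⟩) ∧
    ∀ i j j', (if j < j' then 1 else 0 : ℤ) = (if lv i j < lv i j' then 1 else 0) -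
      ((if lv i j < c i then 1 else 0) - (if lv i j' < c i then 1 else 0)) := by
  obtain ⟨c, hc⟩ := cyclicDatum_exists_pt m
  have hlen := cyclicDatum_cycleLength m
  let lv : ∀ i, Fin (m.cycleLength i) → Fin (r i) := fun i j =>
    ⟨(c i + j) % r i, Nat.mod_lt _ (hr i)⟩
  have hbij : ∀ i, Function.Bijective (lv i) := by
    intro i
    rw [Fintype.bijective_iff_surjective_and_card]
    refine ⟨fun l => ?_, by rw [Fintype.card_fin, Fintype.card_fin, hlen]⟩
    refine ⟨⟨(l + r i - c i) % r i, ?_⟩, Fin.ext ?_⟩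
    · rw [hlen]
      exact Nat.mod_lt _ (hr i)
    · simp only [lv]
      rw [Nat.add_mod_mod]
      have : (c i : ℕ) + (l + r i - c i) = l + r i := by lia
      rw [this, Nat.add_mod_right, Nat.mod_eq_of_lt l.2]
  refine ⟨c, fun i => Equiv.ofBijective (lv i) (hbij i), fun i j => ?_, fun i j j' => ?_⟩
  · change (cyclicShift hr ^ (j : ℕ)) (m.pt i) = _
    rw [hc, cyclicShift_pow]
    rfl
  · have hval : ∀ j : Fin (m.cycleLength i), ((c i : ℕ) + j < r i ∧ (lv i j : ℕ) = c i + j) ∨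
        (r i ≤ (c i : ℕ) + j ∧ (lv i j : ℕ) + r i = c i + j) := by
      intro j
      have hj : (j : ℕ) < r i := by rw [← hlen i]; exact j.2
      rcases lt_or_ge ((c i : ℕ) + j) (r i) with h | h
      · exact Or.inl ⟨h, Nat.mod_eq_of_lt h⟩
      · refine Or.inr ⟨h, ?_⟩
        simp only [lv]
        rw [Nat.mod_eq_sub_mod h, Nat.mod_eq_of_lt (by lia)]
        lia
    have h1 := hval j
    have h2 := hval j'
    have hj : (j : ℕ) < r i := by rw [← hlen i]; exact j.2
    have hj' : (j' : ℕ) < r i := by rw [← hlen i]; exact j'.2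
    simp only [Equiv.ofBijective_apply, Fin.lt_def]
    split_ifs <;> lia

end CyclicDatum

/-! ### Comparison with the order of a marking. -/

section Order

variable {k : Type u} [Field k] {t : ℕ} {s r : Fin t → ℕ} {ℓ : ∀ i, Fin (s i) → Fin (r i)}
  {hr : ∀ i, 0 < r i} {tie : TieRelation (Σ i, Fin (r i))} {wt : WeightFunction tie}

theorem powerSeries_residue_eq_iff {x y : PowerSeries k} :
    IsLocalRing.residue (PowerSeries k) x = IsLocalRing.residue (PowerSeries k) y ↔
      PowerSeries.constantCoeff x = PowerSeries.constantCoeff y := by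
  rw [← sub_eq_zero, ← map_sub, IsLocalRing.residue_eq_zero_iff, IsLocalRing.mem_maximalIdeal,
    mem_nonunits_iff, PowerSeries.isUnit_iff_constantCoeff, isUnit_iff_ne_zero, not_not, map_sub,
    sub_eq_zero]

theorem powerSeries_mem_maximalIdeal_iff {x : PowerSeries k} :
    x ∈ IsLocalRing.maximalIdeal (PowerSeries k) ↔ PowerSeries.constantCoeff x = 0 := by
  rw [IsLocalRing.mem_maximalIdeal, mem_nonunits_iff, PowerSeries.isUnit_iff_constantCoeff,
    isUnit_iff_ne_zero, not_not]

/-- On each block, β is a bijection onto the numbers below the weight, so a stripe and a place in it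
determine one row. -/
theorem cyclicDatum_exists_position_equiv {β : ∀ ω, LevelFiber ℓ ω → ℕ}
    (hinj : ∀ ω, Function.Injective (β ω)) (hrange : ∀ ω c, c < wt.weight ω ↔ ∃ a, β ω a = c)
    (m : (cyclicDatum hr wt).Marking) {lv : ∀ i, Fin (m.cycleLength i) ≃ Fin (r i)}
    (hlv : ∀ i j, m.elt i j = ⟨i, lv i j⟩) :
    ∃ γ : ∀ i, m.Pos i ≃ Fin (s i), ∀ i x, ∃ h : ℓ i (γ i x) = lv i x.1,
      β ⟨i, lv i x.1⟩ ⟨γ i x, h⟩ = x.2 := by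
  have hp : ∀ i j, m.p i j = wt.weight ⟨i, lv i j⟩ := by
    intro i j
    rw [← hlv]
    rfl
  have hex : ∀ i (x : m.Pos i), ∃ a : LevelFiber ℓ ⟨i, lv i x.1⟩, β _ a = x.2 := by
    intro i x
    rw [← hrange, ← hp]
    exact x.2.2
  choose g hg using hex
  let γ : ∀ i, m.Pos i → Fin (s i) := fun i x => (g i x).1
  have hbij : ∀ i, Function.Bijective (γ i) := by
    intro i
    constructor
    · rintro ⟨j, a⟩ ⟨j', b⟩ hab
      have h1 : lv i j = lv i j' :=
        ((g i ⟨j, a⟩).2).symm.trans ((congrArg (ℓ i) hab).trans (g i ⟨j', b⟩).2)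
      obtain rfl := (lv i).injective h1
      have h2 : g i ⟨j, a⟩ = g i ⟨j, b⟩ := Subtype.ext hab
      have h3 : (a : ℕ) = b :=
        (hg i ⟨j, a⟩).symm.trans ((congrArg (β ⟨i, lv i j⟩) h2).trans (hg i ⟨j, b⟩))
      rw [Fin.ext h3]
    · intro b
      obtain ⟨j, hj⟩ := (lv i).surjective (ℓ i b)
      let a : LevelFiber ℓ ⟨i, lv i j⟩ := ⟨b, hj.symm⟩
      have hlt : β _ a < m.p i j := by
        rw [hp, hrange]
        exact ⟨a, rfl⟩
      refine ⟨⟨j, ⟨β _ a, hlt⟩⟩, ?_⟩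
      have := hinj _ (hg i ⟨j, ⟨β _ a, hlt⟩⟩)
      exact congrArg Subtype.val this
  exact ⟨fun i => Equiv.ofBijective _ (hbij i), fun i x => ⟨(g i x).2, hg i x⟩⟩

/-- The order of block triangular matrices with the gluing conditions is conjugate to the order
attached to any marking of the corresponding datum. -/
theorem cyclicDatum_exists_conj_order {β : ∀ ω, LevelFiber ℓ ω → ℕ}
    (hinj : ∀ ω, Function.Injective (β ω)) (hrange : ∀ ω c, c < wt.weight ω ↔ ∃ a, β ω a = c)
    (m : (cyclicDatum hr wt).Marking) :
    ∃ (hp : ∀ i, ∑ j, m.p i j = s i)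
      (T : (∀ i, Matrix (Fin (s i)) (Fin (s i)) (LaurentSeries k))ˣ), ∀ X,
      (IsBlockTri ℓ X ∧ IsGlued wt β
        (fun ω => Matrix.of fun a b => (X ω.1 a.1 b.1).coeff 0)) ↔
      ∃ Y ∈ m.order (PowerSeries k) (LaurentSeries k) hp, T.val * Y * T⁻¹.val = X := by
  obtain ⟨c, lv, hlv, hord⟩ := cyclicDatum_exists_level m
  obtain ⟨γ, hγ⟩ := cyclicDatum_exists_position_equiv hinj hrange m hlv
  choose hγℓ hγβ using hγ
  have hγβ' : ∀ i j (α : Fin (m.p i j)),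
      β ⟨i, lv i j⟩ ⟨γ i ⟨j, α⟩, hγℓ i ⟨j, α⟩⟩ = α := fun i j α => hγβ i ⟨j, α⟩
  have hplus : ∀ (i : Fin t) (j : Fin (m.cycleLength i))
      (hrel : (cyclicDatum hr wt).tie.rel (m.elt i j) (m.elt i j))
      (hrel' : tie.rel ⟨i, lv i j⟩ ⟨i, lv i j⟩) (x y : ℕ), x = y →
      (NodalDatum.Marking.IsPlus hrel x ↔
        y < wt.toFun (Sum.inr (⟨⟨i, lv i j⟩, hrel'⟩, true))) := by
    rintro i j hrel hrel' x _ rfl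
    have : ∀ ω ω' (_ : ω = ω') (h : tie.rel ω ω) (h' : tie.rel ω' ω'),
        x < wt.toFun (Sum.inr (⟨ω, h⟩, true)) ↔ x < wt.toFun (Sum.inr (⟨ω', h'⟩, true)) := by
      rintro ω _ rfl h h'
      exact Iff.rfl
    exact this _ _ (hlv i j) hrel hrel'
  have hp : ∀ i, ∑ j, m.p i j = s i := by
    intro i
    have := Fintype.card_congr (γ i)
    rw [Fintype.card_sigma, Fintype.card_fin] at this
    simpa using this
  -- The rows whose level wraps around are scaled by w.
  let δ : ∀ i, Fin (s i) → ℤ := fun i x => if ℓ i x < c i then 1 else 0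
  obtain ⟨T, hT⟩ := exists_monomial_unit (k := k) (fun i => (γ i).symm.trans (m.posEquiv hp i)) δ
  refine ⟨hp, T, fun X => ?_⟩
  have hentry : ∀ (Y : ∀ i, Matrix (m.Pos i) (m.Pos i) (PowerSeries k)) i u v,
      (T.val * m.toEnvelope (PowerSeries k) (LaurentSeries k) hp Y * T⁻¹.val) i (γ i u) (γ i v) =
      monom k (δ i (γ i u) - δ i (γ i v)) * algebraMap _ _ (Y i u v) := by
    intro Y i u v
    rw [hT]
    simp [NodalDatum.Marking.toEnvelope, Algebra.ofId_apply]
  have hδ : ∀ i u v, (if u.1 < v.1 then 1 else 0 : ℤ) =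
      (if ℓ i (γ i u) < ℓ i (γ i v) then 1 else 0) - (δ i (γ i u) - δ i (γ i v)) := by
    intro i u v
    simp only [δ, hγℓ]
    exact hord i u.1 v.1
  have hpos : ∀ i j (a : LevelFiber ℓ ⟨i, lv i j⟩), ∃ α : Fin (m.p i j),
      γ i ⟨j, α⟩ = a.1 ∧ (α : ℕ) = β _ a := by
    intro i j a
    obtain ⟨⟨j', α⟩, hx⟩ := (γ i).surjective a.1
    have h1 : lv i j' = lv i j := by rw [← hγℓ i ⟨j', α⟩, hx]; exact a.2
    obtain rfl := (lv i).injective h1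
    refine ⟨α, hx, ?_⟩
    rw [← hγβ i ⟨j', α⟩]
    congr 1
    exact Subtype.ext hx
  have hglue : ∀ Y : ∀ i, Matrix (m.Pos i) (m.Pos i) (PowerSeries k),
      (∀ i u v, (X i (γ i u) (γ i v)) =
        monom k (δ i (γ i u) - δ i (γ i v)) * algebraMap _ _ (Y i u v)) →
      ((IsBlockTri ℓ X ∧ IsGlued wt β
        (fun ω => Matrix.of fun a b => (X ω.1 a.1 b.1).coeff 0)) ↔
        Y ∈ m.blockOrder (PowerSeries k)) := by
    intro Y hY
    -- The exponent δ depends only on the level, so the diagonal blocks are not rescaled and the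
    -- gluing conditions carry over.
    have hdiag : ∀ i j a b, (X i (γ i ⟨j, a⟩) (γ i ⟨j, b⟩)).coeff 0 =
        PowerSeries.constantCoeff (Y i ⟨j, a⟩ ⟨j, b⟩) := by
      intro i j a b
      have hδ0 : δ i (γ i ⟨j, a⟩) - δ i (γ i ⟨j, b⟩) = 0 := by
        simp only [δ, hγℓ, sub_self]
      rw [hY, hδ0, monom_zero, one_mul, coeff_zero_algebraMap]
    refine and_congr ?_ (and_congr ?_ ?_)
    · constructor
      · intro h i u v huv
        rw [powerSeries_mem_maximalIdeal_iff, ← coeff_zero_algebraMap]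
        have h1 := h i (γ i u) (γ i v)
        rw [hY, ordGE_monom_mul, ← hδ, if_pos huv] at h1
        exact h1 0 zero_lt_one
      · intro h i x y
        obtain ⟨u, rfl⟩ := (γ i).surjective x
        obtain ⟨v, rfl⟩ := (γ i).surjective y
        rw [hY, ordGE_monom_mul, ← hδ]
        split_ifs with huv
        · intro n hn
          rcases lt_or_ge n 0 with h' | h'
          · exact ordGE_algebraMap _ n h'
          · obtain rfl : n = 0 := by lia
            rw [coeff_zero_algebraMap, ← powerSeries_mem_maximalIdeal_iff]
            exact h i u v huv
        · exact ordGE_algebraMap _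
    · constructor
      · intro h i i' j j' hrel hne a b
        rw [powerSeries_residue_eq_iff, ← hdiag, ← hdiag]
        rw [hlv, hlv] at hrel hne
        refine h _ _ hrel hne ⟨γ i ⟨j, a⟩, hγℓ i ⟨j, a⟩⟩ ⟨γ i ⟨j, b⟩, hγℓ i ⟨j, b⟩⟩
          ⟨γ i' ⟨j', _⟩, hγℓ i' ⟨j', _⟩⟩ ⟨γ i' ⟨j', _⟩, hγℓ i' ⟨j', _⟩⟩ ?_ ?_ <;>
        · rw [hγβ', hγβ']
          rfl
      · rintro h ⟨i, l⟩ ⟨i', l'⟩ hrel hne a b a' b' ha hb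
        obtain ⟨j, rfl⟩ := (lv i).surjective l
        obtain ⟨j', rfl⟩ := (lv i').surjective l'
        rw [← hlv, ← hlv] at hrel hne
        obtain ⟨α, h1, h1'⟩ := hpos i j a
        obtain ⟨α', h2, h2'⟩ := hpos i' j' a'
        obtain ⟨η, h3, h3'⟩ := hpos i j b
        obtain ⟨η', h4, h4'⟩ := hpos i' j' b'
        have := h i i' j j' hrel hne α η
        rw [powerSeries_residue_eq_iff, ← hdiag, ← hdiag] at this
        have e1 : Fin.cast (m.p_eq_of_tied hrel) α = α' :=
          Fin.ext ((h1'.trans ha).trans h2'.symm)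
        have e2 : Fin.cast (m.p_eq_of_tied hrel) η = η' :=
          Fin.ext ((h3'.trans hb).trans h4'.symm)
        rw [e1, e2, h1, h2, h3, h4] at this
        exact this
    · constructor
      · intro h i j hrel a b hab
        rw [← map_zero (IsLocalRing.residue (PowerSeries k)), powerSeries_residue_eq_iff, ← hdiag,
          map_zero]
        have hrel' : tie.rel ⟨i, lv i j⟩ ⟨i, lv i j⟩ := by
          rw [← hlv]
          exact hrel
        refine h _ hrel' ⟨γ i ⟨j, a⟩, hγℓ i ⟨j, a⟩⟩ ⟨γ i ⟨j, b⟩, hγℓ i ⟨j, b⟩⟩ fun h' => hab ?_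
        exact (hplus i j hrel hrel' _ _ (hγβ' i j a).symm).trans
          (h'.trans (hplus i j hrel hrel' _ _ (hγβ' i j b).symm).symm)
      · rintro h ⟨i, l⟩ hrel a b hab
        obtain ⟨j, rfl⟩ := (lv i).surjective l
        have hrel' : tie.rel (m.elt i j) (m.elt i j) := by
          rw [hlv]
          exact hrel
        obtain ⟨α, h1, h1'⟩ := hpos i j a
        obtain ⟨η, h3, h3'⟩ := hpos i j b
        have := h i j hrel' α η fun h' => hab ((hplus i j hrel' hrel _ _ h1').symm.trans
          (h'.trans (hplus i j hrel' hrel _ _ h3')))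
        rw [← map_zero (IsLocalRing.residue (PowerSeries k)), powerSeries_residue_eq_iff, ← hdiag,
          map_zero, h1, h3] at this
        exact this
  constructor
  · intro hX
    -- Undoing the rescaling leaves the exponent 1 or 0 according to the order of the stripes, so
    -- the entries are power series.
    have hY : ∀ i u v, ∃ y, algebraMap (PowerSeries k) (LaurentSeries k) y =
        monom k (-(δ i (γ i u) - δ i (γ i v))) * X i (γ i u) (γ i v) := by
      intro i u v
      apply exists_algebraMap_eq
      rw [ordGE_monom_mul]
      refine (hX.1 i _ _).mono ?_
      have := hδ i u v
      split_ifs at * <;> lia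
    choose Y hY using hY
    have hYX : ∀ i u v, X i (γ i u) (γ i v) =
        monom k (δ i (γ i u) - δ i (γ i v)) * algebraMap _ _ (Y i u v) := by
      intro i u v
      rw [hY, ← mul_assoc, monom_mul_monom_neg, one_mul]
    refine ⟨_, ⟨fun i => Matrix.of (Y i), (hglue _ hYX).mp hX, rfl⟩, ?_⟩
    ext1 i
    refine Matrix.ext fun x y => ?_
    obtain ⟨u, rfl⟩ := (γ i).surjective x
    obtain ⟨v, rfl⟩ := (γ i).surjective y
    rw [hYX]
    exact hentry _ i u v
  · rintro ⟨_, ⟨Y, hY, rfl⟩, rfl⟩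
    exact (hglue Y fun i u v => hentry Y i u v).mpr hY

end Order

/-! ### Nodal orders as gluings. -/

section Main

variable {k : Type u} [Field k] {t : ℕ} {s r : Fin t → ℕ} {ℓ : ∀ i, Fin (s i) → Fin (r i)}

/-- The isomorphism of an order with the conjugate block triangular order. -/
noncomputable def blockTriEquiv
    {H : Subalgebra (PowerSeries k) (∀ i, Matrix (Fin (s i)) (Fin (s i)) (LaurentSeries k))}
    (S : (∀ i, Matrix (Fin (s i)) (Fin (s i)) (LaurentSeries k))ˣ)
    (hS : ∀ X, S.val * X * S⁻¹.val ∈ H ↔ IsBlockTri ℓ X) : blockTriOrder k ℓ ≃+* H where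
  toFun X := ⟨S.val * X.1 * S⁻¹.val, (hS X.1).mpr X.2⟩
  invFun Y := ⟨S⁻¹.val * Y.1 * S.val, (hS _).mp (by simp [mul_assoc])⟩
  left_inv X := Subtype.ext (by simp [mul_assoc])
  right_inv Y := Subtype.ext (by simp [mul_assoc])
  map_mul' X Y := Subtype.ext (by simp [mul_assoc])
  map_add' X Y := Subtype.ext (by simp [mul_add, add_mul])

/-- The reduction modulo the radical of an order conjugate to a block triangular order. -/
noncomputable def blockTriReduction
    {H : Subalgebra (PowerSeries k) (∀ i, Matrix (Fin (s i)) (Fin (s i)) (LaurentSeries k))}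
    (S : (∀ i, Matrix (Fin (s i)) (Fin (s i)) (LaurentSeries k))ˣ)
    (hS : ∀ X, S.val * X * S⁻¹.val ∈ H ↔ IsBlockTri ℓ X) : H →+* ResidueBlocks k ℓ :=
  (residueHom k ℓ).comp (blockTriEquiv S hS).symm.toRingHom

variable {H : Subalgebra (PowerSeries k) (∀ i, Matrix (Fin (s i)) (Fin (s i)) (LaurentSeries k))}
    {S : (∀ i, Matrix (Fin (s i)) (Fin (s i)) (LaurentSeries k))ˣ}
    (hS : ∀ X, S.val * X * S⁻¹.val ∈ H ↔ IsBlockTri ℓ X)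

theorem blockTriReduction_apply (X : blockTriOrder k ℓ) :
    blockTriReduction S hS (blockTriEquiv S hS X) = residueHom k ℓ X := by
  simp [blockTriReduction]

theorem blockTriReduction_surjective : Function.Surjective (blockTriReduction S hS) :=
  residueHom_surjective.comp (blockTriEquiv S hS).symm.surjective

theorem blockTriReduction_isLocalHom : IsLocalHom (blockTriReduction S hS) := by
  refine ⟨fun X hX => ?_⟩
  have h1 := residueHom_isLocalHom.map_nonunit _ hX
  exact (MulEquiv.isUnit_map (blockTriEquiv S hS).symm).mp h1

theorem blockTriReduction_algebraMap_C (c : k) :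
    blockTriReduction S hS (algebraMap (PowerSeries k) _ (PowerSeries.C c)) = algebraMap k _ c := by
  rw [← residueHom_algebraMap_C, ← blockTriReduction_apply hS]
  congr 1
  apply Subtype.ext
  change algebraMap (PowerSeries k) (∀ i, Matrix (Fin (s i)) (Fin (s i)) (LaurentSeries k)) _ =
    S.val * algebraMap (PowerSeries k) _ _ * S⁻¹.val
  rw [← Algebra.commutes, mul_assoc, Units.mul_inv, mul_one]

/-- An order squeezed between the radical of a block triangular order and that order itself, with
few constituents of the induced modules, is a gluing of the block triangular order. -/
theorem exists_glued_form_of_nodal [IsAlgClosed k]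
    (hS : ∀ X, S.val * X * S⁻¹.val ∈ H ↔ IsBlockTri ℓ X) (hℓ : ∀ i, Function.Surjective (ℓ i))
    {A : Subalgebra (PowerSeries k) (∀ i, Matrix (Fin (s i)) (Fin (s i)) (LaurentSeries k))}
    (hAH : A ≤ H)
    (hrad : (Subtype.val '' (Ring.jacobson A : Set A) :
      Set (∀ i, Matrix (Fin (s i)) (Fin (s i)) (LaurentSeries k))) =
      Subtype.val '' (Ring.jacobson H : Set H))
    (hlen : ∀ (U : Type u) [AddCommGroup U] [Module A U], IsSimpleModule A U →
      inducedLength (Subalgebra.inclusion hAH : A →ₐ[PowerSeries k] H).toRingHom U ≤ 2) :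
    ∃ (tie : TieRelation (Σ i, Fin (r i))) (wt : WeightFunction tie)
      (β : ∀ ω, LevelFiber ℓ ω → ℕ) (S' : (∀ i, Matrix (Fin (s i)) (Fin (s i)) (LaurentSeries k))ˣ),
      (∀ ω, Function.Injective (β ω)) ∧ (∀ ω c, c < wt.weight ω ↔ ∃ a, β ω a = c) ∧
      ∀ X, S'.val * X * S'⁻¹.val ∈ A ↔ IsBlockTri ℓ X ∧
        IsGlued wt β (fun ω => Matrix.of fun a b => (X ω.1 a.1 b.1).coeff 0) := by
  classical
  let f : A →+* H := (Subalgebra.inclusion hAH : A →ₐ[PowerSeries k] H).toRingHom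
  let ρ₀ := blockTriReduction S hS
  have hloc : IsLocalHom ρ₀ := blockTriReduction_isLocalHom hS
  have hsurj : Function.Surjective ρ₀ := blockTriReduction_surjective hS
  have hrad' : ∀ a, f a ∈ Ring.jacobson H ↔ a ∈ Ring.jacobson A := by
    intro a
    constructor
    · intro h
      have : a.1 ∈ (Subtype.val '' (Ring.jacobson H : Set H) :
        Set (∀ i, Matrix (Fin (s i)) (Fin (s i)) (LaurentSeries k))) := ⟨f a, h, rfl⟩
      rw [← hrad] at this
      obtain ⟨b, hb, hab⟩ := this
      rwa [← Subtype.ext hab]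
    · intro h
      have : a.1 ∈ (Subtype.val '' (Ring.jacobson A : Set A) :
        Set (∀ i, Matrix (Fin (s i)) (Fin (s i)) (LaurentSeries k))) := ⟨a, h, rfl⟩
      rw [hrad] at this
      obtain ⟨b, hb, hab⟩ := this
      have : b = f a := Subtype.ext hab
      rwa [← this]
  -- C is the image of A in H / rad H.
  let C : Subalgebra k (ResidueBlocks k ℓ) :=
    { (ρ₀.comp f).rangeS with
      algebraMap_mem' := fun c =>
        ⟨algebraMap (PowerSeries k) A (PowerSeries.C c), blockTriReduction_algebraMap_C hS c⟩ }
  have hC : ∀ b, b ∈ C ↔ ∃ a, ρ₀ (f a) = b := fun b => Iff.rfl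
  have hss : IsSemisimpleRing C :=
    isSemisimpleRing_of_image_of_jacobson_eq hsurj hloc hrad' C hC
  obtain ⟨n, d, hd, ⟨ε⟩⟩ := IsSemisimpleRing.exists_algEquiv_pi_matrix_of_isAlgClosed k C
  have hd' : ∀ τ, 0 < d τ := fun τ => Nat.pos_of_ne_zero (hd τ).out
  let ψ : (∀ τ, Matrix (Fin (d τ)) (Fin (d τ)) k) →ₐ[k] ResidueBlocks k ℓ :=
    C.val.comp ε.symm.toAlgHom
  have hψ : Function.Injective ψ := Subtype.val_injective.comp ε.symm.injective
  choose E hE hE' lab e g hg using fun ω =>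
    exists_conj_blockDiagonal hd' ((Pi.evalAlgHom k _ ω).comp ψ)
  let G : (ResidueBlocks k ℓ)ˣ := MulEquiv.piUnits.symm g
  -- The reduction in the adapted bases, where A acts by block diagonal matrices.
  let ρ : H →+* ResidueBlocks k ℓ := (conjAlgHom k G⁻¹).toRingHom.comp ρ₀
  have hρ : Function.Surjective ρ := by
    intro Y
    obtain ⟨h, hh⟩ := hsurj (G.val * Y * G⁻¹.val)
    refine ⟨h, ?_⟩
    change G⁻¹.val * ρ₀ h * G⁻¹⁻¹.val = Y
    rw [hh]
    simp [mul_assoc]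
  let κ : A →+* C := (ρ₀.comp f).codRestrict C fun a => (hC _).mpr ⟨a, rfl⟩
  let θ : A →+* ∀ τ, Matrix (Fin (d τ)) (Fin (d τ)) k :=
    ε.toRingEquiv.toRingHom.comp κ
  have hθ : Function.Surjective θ := by
    intro x
    obtain ⟨a, ha⟩ := (ε.symm x).2
    refine ⟨a, ?_⟩
    have : κ a = ε.symm x := Subtype.ext ha
    change ε (κ a) = x
    rw [this, ε.apply_symm_apply]
  have hψθ : ∀ a, ψ (θ a) = ρ₀ (f a) := by
    intro a
    change (ε.symm (ε (κ a))).1 = _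
    rw [ε.symm_apply_apply]
    rfl
  have hρθ : ∀ a ω i j, ρ (f a) ω i j = if (e ω i).1 = (e ω j).1 then
      natEntry (θ a) (lab ω (e ω i).1) (e ω i).2 (e ω j).2 else 0 := by
    intro a ω i j
    rw [← hg ω (θ a) i j]
    change _ = ((g ω)⁻¹.val * ψ (θ a) ω * (g ω).val) i j
    rw [hψθ]
    rfl
  have hfew : HasFewConstituentPairs lab := by
    intro τ
    have : Nonempty (Fin (d τ)) := ⟨⟨0, hd' τ⟩⟩
    have h1 := card_constituentPair_le_inducedLength hd' ρ hρ θ hρθ τ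
    have h2 := hlen (ColumnModule ((Pi.evalRingHom _ τ).comp θ))
      (ColumnModule.isSimpleModule _ ((Function.surjective_eval τ).comp hθ))
    have h3 : Fintype.card (ConstituentPair lab τ) ≤ 2 := by exact_mod_cast h1.trans h2
    intro ζ₁ ζ₂ ζ₃
    by_contra! hne
    exact absurd (Fintype.two_lt_card_iff.mpr ⟨ζ₁, ζ₂, ζ₃, hne⟩) (not_lt.mpr h3)
  have hne : ∀ ω, Nonempty (E ω) := by
    rintro ⟨i, l⟩
    obtain ⟨a, ha⟩ := hℓ i l
    exact ⟨(e ⟨i, l⟩ ⟨a, ha⟩).1⟩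
  -- If τ did not occur, the identity of the factor τ would act as zero on every block, although ψ
  -- is injective.
  have hT : ∀ τ, ∃ ω z, lab ω z = τ := by
    intro τ
    by_contra! hcon
    have h1 : ψ (Pi.single τ 1) = 0 := by
      ext1 ω
      have h2 : (g ω)⁻¹.val * ψ (Pi.single τ 1) ω * (g ω).val = 0 := by
        ext a b
        refine (hg ω (Pi.single τ 1) a b).trans ?_
        split_ifs
        · rw [natEntry, Pi.single_eq_of_ne (hcon ω _)]
          split_ifs <;> rfl
        · rfl
      have h3 : (g ω).val * ((g ω)⁻¹.val * ψ (Pi.single τ 1) ω * (g ω).val) * (g ω)⁻¹.val =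
          ψ (Pi.single τ 1) ω := by
        simp only [mul_assoc, Units.mul_inv, Units.mul_inv_cancel_left, mul_one]
      rw [← h3, h2, mul_zero, zero_mul]
      rfl
    have h2 := congrFun (hψ (h1.trans (map_zero ψ).symm)) τ
    rw [Pi.single_eq_same] at h2
    have h3 := congrFun (congrFun h2 ⟨0, hd' τ⟩) ⟨0, hd' τ⟩
    rw [Matrix.one_apply_eq] at h3
    exact one_ne_zero h3
  obtain ⟨tie, wt, β, hinj, hrange, hglue⟩ := hfew.exists_datum e hd' hne hT k
  obtain ⟨Γ₀, hΓ₀⟩ := residueHom_surjective (ℓ := ℓ) G.val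
  -- The base change G lifts to a unit of the block triangular order: any lift is a unit because the
  -- reduction is local.
  obtain ⟨Γ, hΓ⟩ := residueHom_isLocalHom.map_nonunit Γ₀ (hΓ₀ ▸ G.isUnit)
  have hΓG : residueHom k ℓ Γ.val = G.val := by rw [hΓ, hΓ₀]
  have hΓG' : residueHom k ℓ Γ⁻¹.val = G⁻¹.val := by
    have h1 : residueHom k ℓ Γ⁻¹.val * G.val = 1 := by
      rw [← hΓG, ← map_mul, Units.inv_mul, map_one]
    exact (Units.inv_eq_of_mul_eq_one_left h1).symm
  let Γ' := Units.map (blockTriOrder k ℓ).val.toRingHom.toMonoidHom Γ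
  have hconj : ∀ X, (S * Γ').val * X * (S * Γ')⁻¹.val =
      S.val * (Γ'.val * X * Γ'⁻¹.val) * S⁻¹.val := by
    intro X
    simp [mul_assoc]
  have hX₀ : ∀ X : blockTriOrder k ℓ, (Γ.val * X * Γ⁻¹.val : blockTriOrder k ℓ).1 =
      Γ'.val * X.1 * Γ'⁻¹.val := fun X => rfl
  have hred : ∀ X : blockTriOrder k ℓ,
      ρ (blockTriEquiv S hS (Γ.val * X * Γ⁻¹.val)) = residueHom k ℓ X := by
    intro X
    change G⁻¹.val * ρ₀ _ * G⁻¹⁻¹.val = _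
    rw [blockTriReduction_apply hS, map_mul, map_mul, hΓG, hΓG']
    simp [mul_assoc]
  refine ⟨tie, wt, β, S * Γ', hinj, hrange, fun X => ?_⟩
  rw [hconj]
  constructor
  · intro hXA
    have h1 : IsBlockTri ℓ (Γ'.val * X * Γ'⁻¹.val) := (hS _).mp (hAH hXA)
    let Z : blockTriOrder k ℓ := Γ⁻¹.val * ⟨_, h1⟩ * Γ.val
    have hZ : Z.1 = X := by
      change Γ'⁻¹.val * (Γ'.val * X * Γ'⁻¹.val) * Γ'.val = X
      simp [mul_assoc]
    have hZ' : Γ.val * Z * Γ⁻¹.val = ⟨_, h1⟩ := by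
      simp [Z, mul_assoc]
    refine ⟨hZ ▸ Z.2, ?_⟩
    refine (hglue _).mp ⟨θ ⟨_, hXA⟩, fun ω a b => ?_⟩
    rw [← hρθ]
    have h2 := hred Z
    rw [hZ'] at h2
    have h3 : f ⟨_, hXA⟩ = blockTriEquiv S hS ⟨_, h1⟩ := rfl
    rw [h3, h2, residueHom_apply, hZ]
    rfl
  · rintro ⟨hX, hX'⟩
    obtain ⟨x, hx⟩ := (hglue _).mpr hX'
    let Z : blockTriOrder k ℓ := ⟨X, hX⟩
    obtain ⟨a, ha⟩ := hθ x
    have h1 : residueHom k ℓ Z = ρ (f a) := by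
      ext ω i j
      rw [hρθ, ha, ← hx]
      rfl
    rw [← hred] at h1
    set y := blockTriEquiv S hS (Γ.val * Z * Γ⁻¹.val) with hy
    have h2 : ρ₀ y = ρ₀ (f a) := conjAlgHom_injective (R := k) G⁻¹ h1
    -- An element of A with the same residue differs from y by an element of rad H = rad A, so y
    -- itself lies in A.
    have h3 : y - f a ∈ Ring.jacobson H := by
      rw [Ring.jacobson_eq_ker ρ₀ hsurj hloc, RingHom.mem_ker, map_sub, h2, sub_self]
    have h4 : (y - f a).1 ∈ (Subtype.val '' (Ring.jacobson H : Set H) :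
        Set (∀ i, Matrix (Fin (s i)) (Fin (s i)) (LaurentSeries k))) := ⟨_, h3, rfl⟩
    rw [← hrad] at h4
    obtain ⟨b, -, hb⟩ := h4
    have h5 : y.1 = (b + a).1 := by
      have h6 : (b + a).1 = b.1 + a.1 := rfl
      have h7 : (y - f a).1 = y.1 - a.1 := rfl
      rw [h6, hb, h7, sub_add_cancel]
    have h8 : y.1 = S.val * (Γ'.val * X * Γ'⁻¹.val) * S⁻¹.val := rfl
    rw [← h8, h5]
    exact (b + a).2

end Main

theorem theoremT {k : Type u} [Field k] [IsAlgClosed k] {t : ℕ} (s : Fin t → ℕ)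
    (hs : ∀ i, 0 < s i)
    (A : Subalgebra (PowerSeries k) (∀ i, Matrix (Fin (s i)) (Fin (s i)) (LaurentSeries k)))
    (hA : IsNodalOrder (LaurentSeries k) A) :
    ∃ D : NodalDatum t, ∀ m : D.Marking, ∃ (hp : ∀ i, ∑ j, m.p i j = s i)
      (S : (∀ i, Matrix (Fin (s i)) (Fin (s i)) (LaurentSeries k))ˣ),
      (A : Set (∀ i, Matrix (Fin (s i)) (Fin (s i)) (LaurentSeries k))) =
        (fun X => S.val * X * S⁻¹.val) '' (m.order (PowerSeries k) (LaurentSeries k) hp) := by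
  obtain ⟨H, hAH, hher, hrad, hlen⟩ := hA.exists_cover
  obtain ⟨S, r, ℓ, hℓ, hS⟩ := exists_conj_blockTriangular hs hher.hasTwoGeneratorSplitting
    (hA.isOrder.isFull.mono hAH.le) (hAH.hasBoundedPoles (hasBoundedPoles_of_fg hA.isOrder.fg))
  -- Each matrix factor has a row, hence at least one level, so no cycle is empty.
  have hr : ∀ i, 0 < r i := fun i => (Nat.zero_le _).trans_lt (ℓ i ⟨0, hs i⟩).2
  obtain ⟨tie, wt, β, S', hinj, hrange, hS'⟩ :=
    exists_glued_form_of_nodal hS hℓ hAH.le hrad hlen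
  refine ⟨cyclicDatum hr wt, fun m => ?_⟩
  obtain ⟨hp, T, hT⟩ := cyclicDatum_exists_conj_order (k := k) hinj hrange m
  refine ⟨hp, S' * T, ?_⟩
  ext y
  have h1 : y = S'.val * (S'⁻¹.val * y * S'.val) * S'⁻¹.val := by simp [mul_assoc]
  rw [SetLike.mem_coe, h1, hS', hT]
  simp only [Set.mem_image]
  refine exists_congr fun Y => and_congr_right fun _ => ?_
  rw [← h1]
  constructor
  · intro h
    have h2 : (S' * T).val * Y * (S' * T)⁻¹.val = S'.val * (T.val * Y * T⁻¹.val) * S'⁻¹.val := by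
      simp [mul_assoc]
    rw [h2, h, ← h1]
  · rintro rfl
    simp [mul_assoc]
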